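/- Let $d,n,p\in\mathbb N$, let $x_1,\dots,x_n\in\mathbb R^d$, $m_i\ge 0$ with $\sum_i m_i=1$, and $\mu=\sum_{i=1}^n m_i\delta_{x_i}$. For nodes $P=(P_1,\dots,P_{p+1})\in(\mathbb R^d)^{p+1}$ and densities $\rho=(\rho_1,\dots,\rho_p)$, $\rho_\alpha\ge 0$, put $$\nu=\nu(P,\rho)=\sum_{\alpha=1}^p\rho_\alpha\, l^\alpha_\#\lambda_{[0,1]},\qquad l^\alpha(t)=(1-t)P_\alpha+tP_{\alpha+1},$$ where $\lambda_{[0,1]}$ is Lebesgue measure on $[0,1]$. For $\phi\in\mathbb R^n$ let $$\mathcal L_i(\phi)=\{y\in\mathbb R^d:\ \|y-x_i\|^2-\phi_i\le\|y-x_j\|^2-\phi_j\ \ \forall j\},\qquad g(\phi,\nu)=\sum_{i}\int_{\mathcal L_i(\phi)}\bigl(\|y-x_i\|^2-\phi_i\bigr)\,d\nu(y)+\sum_i m_i\phi_i .$$ Let $W_2^2(\mu,\nu)$ be the infimum of $\int\|y-z\|^2\,d\gamma(y,z)$ over all couplings $\gamma$ of $\mu$ and $\nu$. Let $\mathcal K(\alpha)$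 be the set of $i$ with $\mathcal L_i(\phi)\cap[P_\alpha,P_{\alpha+1}]\ne\emptyset$, and $\mathcal I=\{(i,\alpha): i\in\mathcal K(\alpha)\}$. For $(i,\alpha)\in\mathcal I$ let $t_s^{i\alpha}\le t_e^{i\alpha}$ be the least and the greatest $t\in[0,1]$ with $l^\alpha(t)\in\mathcal L_i(\phi)$, and let $r^{i\alpha}(t)=(\|l^\alpha(t)-x_i\|^2-\phi_i)\rho_\alpha$. Assume $\sum_\alpha\rho_\alpha=1$ and $$\text{(H)}\qquad \langle P_{\alpha+1}-P_\alpha,\ x_i-x_j\rangle\neq 0\qquad\text{for all }1\le\alpha\le p\text{ and all } i\ne j .$$ Then $g(\cdot,\nu)$ attains its maximum over $\mathbb R^n$, and for every maximizer $\phi^\star$ the following hold, with $\mathcal I,\mathcal K,t_s,t_e,r$ taken at $\phi=\phi^\star$. 1. $G(\nu):=W_2^2(\mu,\nu)=g(\phi^\star,\nu)$. 2. Let $s\mapsto(P(s),\rho(s))$ be a family of parameters, differentiable at $s=0$, with $(P(0),\rho(0))=(P,\rho)$ and $\rho_\alpha(s)\ge0$ for $s$ near $0$; let $\nu(s)$ be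 the corresponding measure and $\partial_\nu$ the derivative at $s=0$ with $\phi^\star$ fixed. (a) $s\mapsto g(\phi^\star,\nu(s))$ is differentiable at $0$, with derivative $$\sum_{(i,\alpha)\in\mathcal I}\int_{t_s^{i\alpha}}^{t_e^{i\alpha}}\partial_\nu r^{i\alpha}(t)\,dt .$$ (b) If the times $t_s^{i\alpha},t_e^{i\alpha}$, $(i,\alpha)\in\mathcal I$, are differentiable along the family at $s=0$ (with $t_s^{i\alpha}=t_e^{i\alpha}=0$ by convention at those $s$ where the $i$-th cell misses the $\alpha$-th segment), then the boundary terms cancel: $$\sum_{(i,\alpha)\in\mathcal I}\Bigl[(\partial_\nu t_e^{i\alpha})\,r^{i\alpha}(t_e^{i\alpha})-(\partial_\nu t_s^{i\alpha})\,r^{i\alpha}(t_s^{i\alpha})\Bigr]=0 .$$ (c) Suppose that $\sum_\alpha\rho_\alpha(s)=1$ for $s$ near $0$, and that either $\rho(s)=\rho$ for $s$ near $0$, or there are maximizers $\psi(s)$ of $g(\cdot,\nu(s))$ for $s$ near $0$ such that $\psi(0)=\phi^\star$ and $\psi$ is continuous at $0$. Then $s\mapsto G(\nu(s))=W_2^2(\mu,\nu(s))$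 is differentiable at $0$, with the same derivative as in (a). 3. For every node $P_\alpha$, $1\le\alpha\le p+1$, both $G(\nu)$ and $g(\phi^\star,\nu)$ ($\phi^\star$ fixed), as functions of $P_\alpha$ with the other parameters fixed, are differentiable at $P_\alpha$, and both have the gradient $$\frac{\partial G}{\partial P_\alpha}=\Bigl(P_\alpha+\frac{P_{\alpha-1}-P_\alpha}{3}-2\sum_{i\in\mathcal K(\alpha-1)}\int_{t_s^{i(\alpha-1)}}^{t_e^{i(\alpha-1)}}t\,x_i\,dt\Bigr)\rho_{\alpha-1}+\Bigl(P_\alpha+\frac{P_{\alpha+1}-P_\alpha}{3}-2\sum_{i\in\mathcal K(\alpha)}\int_{1-t_e^{i\alpha}}^{1-t_s^{i\alpha}}t\,x_i\,dt\Bigr)\rho_\alpha ,$$ where the first term is absent for $\alpha=1$ and the second is absent for $\alpha=p+1$. -/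

import Mathlib

open MeasureTheory Set Filter Topology
open scoped ENNReal

namespace PolylineOT

noncomputable section

/-- The ambient space `ℝᵈ` with its Euclidean norm. -/
abbrev Pt (d : ℕ) : Type := EuclideanSpace ℝ (Fin d)

/-! ### The Kantorovich problem -/

/-- `γ` is a coupling of `μ` and `ν`: its marginals are `μ` and `ν`. -/
def IsCoupling {d : ℕ} (μ ν : Measure (Pt d)) (γ : Measure (Pt d × Pt d)) : Prop :=
  γ.map Prod.fst = μ ∧ γ.map Prod.snd = ν

/-- The squared 2-Wasserstein distance, as the value of the Kantorovich problem for the cost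
`‖y - z‖²`.  The infimum is taken in `[0, ∞]`. -/
def W2sq {d : ℕ} (μ ν : Measure (Pt d)) : ℝ :=
  (⨅ (γ : Measure (Pt d × Pt d)) (_ : IsCoupling μ ν γ), ∫⁻ q, ‖q.1 - q.2‖ₑ ^ 2 ∂γ).toReal

/-! ### The two measures -/

/-- The atomic measure `∑ i, m i δ_{x i}`. -/
def atomic {d n : ℕ} (x : Fin n → Pt d) (m : Fin n → ℝ) : Measure (Pt d) :=
  ∑ i, ENNReal.ofReal (m i) • Measure.dirac (x i)

/-- The parametrization `t ↦ (1 - t) P_α + t P_{α+1}` of the `α`-th segment.  A polyline with `p`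
segments has the `p + 1` nodes `P 0, …, P p`; the segment `α : Fin p` joins the nodes
`α.castSucc` and `α.succ`. -/
def seg {d p : ℕ} (P : Fin (p + 1) → Pt d) (α : Fin p) (t : ℝ) : Pt d :=
  (1 - t) • P α.castSucc + t • P α.succ

/-- The measure `∑ α, ρ α (l^α)_# λ_{[0,1]}` carried by the polyline. -/
def polyline {d p : ℕ} (P : Fin (p + 1) → Pt d) (ρ : Fin p → ℝ) : Measure (Pt d) :=
  ∑ α, ENNReal.ofReal (ρ α) • (volume.restrict (Icc (0 : ℝ) 1)).map (seg P α)

/-- The genericity hypothesis (H). -/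
def Generic {d n p : ℕ} (x : Fin n → Pt d) (P : Fin (p + 1) → Pt d) : Prop :=
  ∀ (α : Fin p) (i j : Fin n), i ≠ j →
    inner ℝ (P α.succ - P α.castSucc) (x i - x j) ≠ 0

/-! ### Laguerre cells and the dual functional -/

/-- The `i`-th Laguerre cell for the sites `x` and the weights `φ`. -/
def laguerre {d n : ℕ} (x : Fin n → Pt d) (φ : Fin n → ℝ) (i : Fin n) : Set (Pt d) :=
  {y | ∀ j, ‖y - x i‖ ^ 2 - φ i ≤ ‖y - x j‖ ^ 2 - φ j}

/-- The dual functional `g(φ, ν)`, for `ν` the polyline measure with parameters `(P, ρ)`. -/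
def dual {d n p : ℕ} (x : Fin n → Pt d) (m : Fin n → ℝ) (φ : Fin n → ℝ)
    (P : Fin (p + 1) → Pt d) (ρ : Fin p → ℝ) : ℝ :=
  ∑ i, ∫ y in laguerre x φ i, (‖y - x i‖ ^ 2 - φ i) ∂(polyline P ρ) + ∑ i, m i * φ i

/-- `φ` is a solution of the dual problem: it maximizes `g(·, ν)` over `ℝⁿ`. -/
def IsOptimal {d n p : ℕ} (x : Fin n → Pt d) (m : Fin n → ℝ)
    (P : Fin (p + 1) → Pt d) (ρ : Fin p → ℝ) (φ : Fin n → ℝ) : Prop :=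
  ∀ ψ : Fin n → ℝ, dual x m ψ P ρ ≤ dual x m φ P ρ

/-! ### Intersections of the segments with the cells -/

open Classical in
/-- `K(α)`: the indices of the cells that meet the segment `[P_α, P_{α+1}]`. -/
def meeting {d n p : ℕ} (x : Fin n → Pt d) (φ : Fin n → ℝ)
    (P : Fin (p + 1) → Pt d) (α : Fin p) : Finset (Fin n) :=
  Finset.univ.filter fun i =>
    (laguerre x φ i ∩ segment ℝ (P α.castSucc) (P α.succ)).Nonempty

open Classical in
/-- `I`: the pairs `(i, α)` such that the `i`-th cell meets the `α`-th segment. -/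
def incidence {d n p : ℕ} (x : Fin n → Pt d) (φ : Fin n → ℝ)
    (P : Fin (p + 1) → Pt d) : Finset (Fin n × Fin p) :=
  Finset.univ.filter fun q => q.1 ∈ meeting x φ P q.2

/-- The starting time `t_s^{iα}` of the `α`-th segment in the `i`-th cell. -/
def tStart {d n p : ℕ} (x : Fin n → Pt d) (φ : Fin n → ℝ)
    (P : Fin (p + 1) → Pt d) (i : Fin n) (α : Fin p) : ℝ :=
  sInf {t | t ∈ Icc (0 : ℝ) 1 ∧ seg P α t ∈ laguerre x φ i}

/-- The ending time `t_e^{iα}` of the `α`-th segment in the `i`-th cell. -/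
def tEnd {d n p : ℕ} (x : Fin n → Pt d) (φ : Fin n → ℝ)
    (P : Fin (p + 1) → Pt d) (i : Fin n) (α : Fin p) : ℝ :=
  sSup {t | t ∈ Icc (0 : ℝ) 1 ∧ seg P α t ∈ laguerre x φ i}

/-- The integrand `r^{iα}(t) = (‖l^α(t) - x_i‖² - φ_i) ρ_α`. -/
def cost {d n p : ℕ} (x : Fin n → Pt d) (φ : Fin n → ℝ)
    (P : Fin (p + 1) → Pt d) (ρ : Fin p → ℝ) (i : Fin n) (α : Fin p) (t : ℝ) : ℝ :=
  (‖seg P α t - x i‖ ^ 2 - φ i) * ρ α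

/-- `∑_{(i,α) ∈ I} ∫_{t_s}^{t_e} ∂_ν r^{iα}(t) dt`, where `∂_ν` is the derivative at `s = 0` along
the family `(P s, ρ s)` of parameters, and `φ` is kept fixed. -/
def interiorTerms {d n p : ℕ} (x : Fin n → Pt d) (φ : Fin n → ℝ)
    (P : ℝ → Fin (p + 1) → Pt d) (ρ : ℝ → Fin p → ℝ) : ℝ :=
  ∑ q ∈ incidence x φ (P 0),
    ∫ t in (tStart x φ (P 0) q.1 q.2)..(tEnd x φ (P 0) q.1 q.2),
      deriv (fun s => cost x φ (P s) (ρ s) q.1 q.2 t) 0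

/-- `∑_{(i,α) ∈ I} (∂_ν t_e^{iα}) r^{iα}(t_e^{iα}) - (∂_ν t_s^{iα}) r^{iα}(t_s^{iα})`, where `∂_ν`
is the derivative at `s = 0` along the family `(P s, ρ s)`, and `φ` is kept fixed. -/
def boundaryTerms {d n p : ℕ} (x : Fin n → Pt d) (φ : Fin n → ℝ)
    (P : ℝ → Fin (p + 1) → Pt d) (ρ : ℝ → Fin p → ℝ) : ℝ :=
  ∑ q ∈ incidence x φ (P 0),
    (deriv (fun s => tEnd x φ (P s) q.1 q.2) 0 *
        cost x φ (P 0) (ρ 0) q.1 q.2 (tEnd x φ (P 0) q.1 q.2) -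
      deriv (fun s => tStart x φ (P s) q.1 q.2) 0 *
        cost x φ (P 0) (ρ 0) q.1 q.2 (tStart x φ (P 0) q.1 q.2))

/-! ### The torque -/

/-- Contribution of the segment `α` to the derivative with respect to its last node `P_{α+1}`. -/
def torqueLast {d n p : ℕ} (x : Fin n → Pt d) (φ : Fin n → ℝ)
    (P : Fin (p + 1) → Pt d) (ρ : Fin p → ℝ) (α : Fin p) : Pt d :=
  ρ α • (P α.succ + (1 / 3 : ℝ) • (P α.castSucc - P α.succ)
    - (2 : ℝ) • ∑ i ∈ meeting x φ P α,
        ∫ t in (tStart x φ P i α)..(tEnd x φ P i α), t • x i)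

/-- Contribution of the segment `α` to the derivative with respect to its first node `P_α`; the
times are those of the reverse parametrization of the segment. -/
def torqueFirst {d n p : ℕ} (x : Fin n → Pt d) (φ : Fin n → ℝ)
    (P : Fin (p + 1) → Pt d) (ρ : Fin p → ℝ) (α : Fin p) : Pt d :=
  ρ α • (P α.castSucc + (1 / 3 : ℝ) • (P α.succ - P α.castSucc)
    - (2 : ℝ) • ∑ i ∈ meeting x φ P α,
        ∫ t in (1 - tEnd x φ P i α)..(1 - tStart x φ P i α), t • x i)

/-- The sum of the contributions at the node `β` of the segments that end or start there (two for
an inner node, one for an end node of the polyline). -/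
def torque {d n p : ℕ} (x : Fin n → Pt d) (φ : Fin n → ℝ)
    (P : Fin (p + 1) → Pt d) (ρ : Fin p → ℝ) (β : Fin (p + 1)) : Pt d :=
  ∑ α : Fin p, ((if α.succ = β then torqueLast x φ P ρ α else 0)
    + (if α.castSucc = β then torqueFirst x φ P ρ α else 0))

end

end PolylineOT

open PolylineOT

/-!
Write `c_φ(y) = minᵢ (‖y - x_i‖² - φ_i)`.  Two of the costs `‖y - x_i‖² - φ_i` differ on a segment
by an affine function of the time, whose slope is nonzero by genericity.  Hence the minimizing site
is unique for almost every time, the cells cut `[0, 1]` into intervals that are disjoint up to null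
sets (`Generic.sum_restrict_cellTimes`), and the dual functional is
`∑ α, ρ_α ∫₀¹ c_φ(l^α(t)) dt + ∑ i, m_i φ_i` (`Generic.dual_eq_sum_segMin`).  In this form the moving
cells have disappeared.  The integrand is locally Lipschitz in the nodes and the weights, and almost
every time has a unique minimizer, so that the integral is differentiable in both, with the
derivative of the cost frozen to the cells (`Generic.hasFDerivAt_segMin`).  As the generic node
configurations form an open set, this applies to all nearby polylines as well.

*Duality.*  A maximizer exists by a compactness argument (`Generic.exists_isOptimal`).  The
derivative in the weights vanishes there, which says that the `i`-th cell has mass `m_i`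
(`IsOptimal.sum_cellTimes`).  The plan that sends each cell to its site is then a coupling, and its
cost is the value of the dual functional, which is a lower bound for the cost of any coupling
(`Generic.ofReal_dual_le_lintegral`, `IsOptimal.W2sq_eq_dual`).

*Derivatives of the squared distance.*  When the nodes move and the densities stay fixed, the times
spent in the original cells keep their masses, so that the old assignment of times to sites is still
a coupling (`Generic.isCoupling_cellPlan`).  The squared distance thus lies between the dual
functional at the fixed maximizer and the cost of the fixed assignment.  Both touch it at the
original nodes, with the same derivative (`IsOptimal.hasFDerivAt_W2sq`); no convergence of
maximizers is needed.  For varying densities, duality at the maximizers `ψ s` gives the same upper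
bound up to the term `∑ α, (ρ_α(s) - ρ_α(0)) ∫₀¹ c_{ψ(s)}(l^α_s(t)) dt`
(`IsOptimal.hasDerivAt_W2sq`).

*Boundary terms.*  The integral of a fixed continuous function over the moving intervals
`[tStart, tEnd]` always adds up to its integral over `[0, 1]`.  Differentiation of this identity, for
the function `c_φ ∘ l^α`, gives the cancellation (`Generic.boundaryTerms_eq_zero`).
-/

namespace PolylineOT

noncomputable section

/-! ### Pointwise costs and the measure carried by a polyline -/

/-- The shifted cost `‖y - x_i‖² - φ_i` of sending the point `y` to the `i`-th site. -/
def siteCost {d n : ℕ} (x : Fin n → Pt d) (φ : Fin n → ℝ) (i : Fin n) (y : Pt d) : ℝ :=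
  ‖y - x i‖ ^ 2 - φ i

/-- The `c`-transform `y ↦ minᵢ (‖y - x_i‖² - φ_i)` of the weights `φ`. -/
def minCost {d n : ℕ} [Nonempty (Fin n)] (x : Fin n → Pt d) (φ : Fin n → ℝ) (y : Pt d) : ℝ :=
  Finset.univ.inf' Finset.univ_nonempty fun i => siteCost x φ i y

/-- The set of times in `[0, 1]` that the `α`-th segment spends in the `i`-th cell. -/
def cellTimes {d n p : ℕ} (x : Fin n → Pt d) (φ : Fin n → ℝ)
    (P : Fin (p + 1) → Pt d) (i : Fin n) (α : Fin p) : Set ℝ :=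
  {t | t ∈ Icc (0 : ℝ) 1 ∧ seg P α t ∈ laguerre x φ i}

/-- `seg P α t = (1 - t) P_α + t P_{α+1}` as a continuous linear map of the nodes `P`. -/
def segL {d p : ℕ} (α : Fin p) (t : ℝ) : (Fin (p + 1) → Pt d) →L[ℝ] Pt d :=
  (1 - t) • ContinuousLinearMap.proj (R := ℝ) (φ := fun _ : Fin (p + 1) => Pt d) α.castSucc +
    t • ContinuousLinearMap.proj (R := ℝ) (φ := fun _ : Fin (p + 1) => Pt d) α.succ

variable {d n p : ℕ} {x : Fin n → Pt d} {φ : Fin n → ℝ} {P : Fin (p + 1) → Pt d} {ρ : Fin p → ℝ}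
  {m : Fin n → ℝ}

theorem norm_seg_le (P : Fin (p + 1) → Pt d) (α : Fin p) {t : ℝ} (ht : t ∈ Icc (0 : ℝ) 1) :
    ‖seg P α t‖ ≤ ‖P‖ := by
  have h1 := norm_le_pi_norm P α.castSucc
  have h2 := norm_le_pi_norm P α.succ
  calc ‖seg P α t‖ ≤ (1 - t) * ‖P α.castSucc‖ + t * ‖P α.succ‖ := by
        refine (norm_add_le _ _).trans ?_
        rw [norm_smul, norm_smul, Real.norm_of_nonneg ht.1,
          Real.norm_of_nonneg (by linarith [ht.2])]
    _ ≤ (1 - t) * ‖P‖ + t * ‖P‖ :=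
        add_le_add (mul_le_mul_of_nonneg_left h1 (by linarith [ht.2]))
          (mul_le_mul_of_nonneg_left h2 ht.1)
    _ = ‖P‖ := by ring

theorem seg_sub (P Q : Fin (p + 1) → Pt d) (α : Fin p) (t : ℝ) :
    seg (P - Q) α t = seg P α t - seg Q α t := (segL α t).map_sub P Q

theorem continuous_seg_uncurry (α : Fin p) :
    Continuous fun z : (Fin (p + 1) → Pt d) × ℝ => seg z.1 α z.2 := by
  unfold seg
  fun_prop

@[fun_prop] theorem continuous_seg (P : Fin (p + 1) → Pt d) (α : Fin p) :
    Continuous (seg P α) := by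
  unfold seg
  fun_prop

@[fun_prop] theorem continuous_siteCost (x : Fin n → Pt d) (φ : Fin n → ℝ) (i : Fin n) :
    Continuous (siteCost x φ i) := by
  unfold siteCost
  fun_prop

@[fun_prop] theorem continuous_minCost [Nonempty (Fin n)] (x : Fin n → Pt d) (φ : Fin n → ℝ) :
    Continuous (minCost x φ) :=
  Continuous.finset_inf'_apply _ fun i _ => continuous_siteCost x φ i

theorem minCost_le [Nonempty (Fin n)] (x : Fin n → Pt d) (φ : Fin n → ℝ) (i : Fin n) (y : Pt d) :
    minCost x φ y ≤ siteCost x φ i y := Finset.inf'_le _ (Finset.mem_univ i)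

theorem exists_minCost_eq [Nonempty (Fin n)] (x : Fin n → Pt d) (φ : Fin n → ℝ) (y : Pt d) :
    ∃ i, minCost x φ y = siteCost x φ i y := by
  obtain ⟨i, -, hi⟩ := Finset.exists_mem_eq_inf' Finset.univ_nonempty fun i => siteCost x φ i y
  exact ⟨i, hi⟩

theorem le_minCost [Nonempty (Fin n)] {y : Pt d} {c : ℝ} (h : ∀ i, c ≤ siteCost x φ i y) :
    c ≤ minCost x φ y := Finset.le_inf' _ _ fun i _ => h i

theorem minCost_eq_of_mem [Nonempty (Fin n)] {i : Fin n} {y : Pt d} (h : y ∈ laguerre x φ i) :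
    minCost x φ y = siteCost x φ i y :=
  le_antisymm (minCost_le x φ i y) (le_minCost h)

theorem exists_mem_laguerre [Nonempty (Fin n)] (x : Fin n → Pt d) (φ : Fin n → ℝ) (y : Pt d) :
    ∃ i, y ∈ laguerre x φ i := by
  obtain ⟨i, hi⟩ := exists_minCost_eq x φ y
  exact ⟨i, fun j => hi.symm.trans_le (minCost_le x φ j y)⟩

theorem isClosed_laguerre (x : Fin n → Pt d) (φ : Fin n → ℝ) (i : Fin n) :
    IsClosed (laguerre x φ i) := by
  simp only [laguerre, ofPred_forall]
  exact isClosed_iInter fun j =>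
    isClosed_le (continuous_siteCost x φ i) (continuous_siteCost x φ j)

/-- The difference of two shifted costs is affine along a segment. -/
theorem siteCost_sub_siteCost_seg (x : Fin n → Pt d) (φ : Fin n → ℝ) (P : Fin (p + 1) → Pt d)
    (α : Fin p) (i j : Fin n) (t : ℝ) :
    siteCost x φ i (seg P α t) - siteCost x φ j (seg P α t) =
      (siteCost x φ i (P α.castSucc) - siteCost x φ j (P α.castSucc)) -
        2 * inner ℝ (P α.succ - P α.castSucc) (x i - x j) * t := by
  have hs : seg P α t = P α.castSucc + t • (P α.succ - P α.castSucc) := by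
    unfold seg; module
  rw [hs]
  generalize P α.succ - P α.castSucc = u
  generalize P α.castSucc = a
  have key : ∀ z : Pt d, ‖a + t • u - z‖ ^ 2 =
      ‖a - z‖ ^ 2 + 2 * t * (inner ℝ u a - inner ℝ u z) + t ^ 2 * ‖u‖ ^ 2 := by
    intro z
    rw [show a + t • u - z = (a - z) + t • u by abel, norm_add_sq_real, inner_smul_right,
      norm_smul, mul_pow, real_inner_comm, inner_sub_right, Real.norm_eq_abs, sq_abs]
    ring
  simp only [siteCost, key, inner_sub_right]
  ring

/-! ### Times spent in the cells -/

theorem isClosed_cellTimes (x : Fin n → Pt d) (φ : Fin n → ℝ) (P : Fin (p + 1) → Pt d)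
    (i : Fin n) (α : Fin p) : IsClosed (cellTimes x φ P i α) :=
  isClosed_Icc.inter ((isClosed_laguerre x φ i).preimage (continuous_seg P α))

theorem cellTimes_subset (x : Fin n → Pt d) (φ : Fin n → ℝ) (P : Fin (p + 1) → Pt d)
    (i : Fin n) (α : Fin p) : cellTimes x φ P i α ⊆ Icc 0 1 := fun _ h => h.1

theorem measurableSet_cellTimes (x : Fin n → Pt d) (φ : Fin n → ℝ) (P : Fin (p + 1) → Pt d)
    (i : Fin n) (α : Fin p) : MeasurableSet (cellTimes x φ P i α) :=
  (isClosed_cellTimes x φ P i α).measurableSet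

theorem isCompact_cellTimes (x : Fin n → Pt d) (φ : Fin n → ℝ) (P : Fin (p + 1) → Pt d)
    (i : Fin n) (α : Fin p) : IsCompact (cellTimes x φ P i α) :=
  isCompact_Icc.of_isClosed_subset (isClosed_cellTimes x φ P i α) (cellTimes_subset x φ P i α)

theorem ordConnected_cellTimes (x : Fin n → Pt d) (φ : Fin n → ℝ) (P : Fin (p + 1) → Pt d)
    (i : Fin n) (α : Fin p) : OrdConnected (cellTimes x φ P i α) := by
  refine ⟨fun s hs t ht r hr => ⟨⟨hs.1.1.trans hr.1, hr.2.trans ht.1.2⟩, fun j => ?_⟩⟩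
  have h1 := hs.2 j
  have h2 := ht.2 j
  have es := siteCost_sub_siteCost_seg x φ P α i j s
  have et := siteCost_sub_siteCost_seg x φ P α i j t
  have er := siteCost_sub_siteCost_seg x φ P α i j r
  simp only [siteCost] at es et er
  rcases le_total 0 (inner ℝ (P α.succ - P α.castSucc) (x i - x j)) with h | h
  · linarith [mul_le_mul_of_nonneg_left hr.1 h]
  · linarith [mul_le_mul_of_nonpos_left hr.2 h]

theorem cellTimes_eq_Icc {i : Fin n} {α : Fin p} (h : (cellTimes x φ P i α).Nonempty) :
    cellTimes x φ P i α = Icc (tStart x φ P i α) (tEnd x φ P i α) := by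
  have hc := isCompact_cellTimes x φ P i α
  refine Subset.antisymm
    (fun t ht => ⟨csInf_le hc.bddBelow ht, le_csSup hc.bddAbove ht⟩) ?_
  exact (ordConnected_cellTimes x φ P i α).out (hc.sInf_mem h) (hc.sSup_mem h)

theorem tStart_mem {i : Fin n} {α : Fin p} (h : (cellTimes x φ P i α).Nonempty) :
    tStart x φ P i α ∈ cellTimes x φ P i α := (isCompact_cellTimes x φ P i α).sInf_mem h

theorem tEnd_mem {i : Fin n} {α : Fin p} (h : (cellTimes x φ P i α).Nonempty) :
    tEnd x φ P i α ∈ cellTimes x φ P i α := (isCompact_cellTimes x φ P i α).sSup_mem h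

theorem mem_meeting_iff {i : Fin n} {α : Fin p} :
    i ∈ meeting x φ P α ↔ (cellTimes x φ P i α).Nonempty := by
  simp only [meeting, Finset.mem_filter, Finset.mem_univ, true_and, segment_eq_image]
  constructor
  · rintro ⟨_, hy, t, ht, rfl⟩
    exact ⟨t, ht, hy⟩
  · rintro ⟨t, ht, hy⟩
    exact ⟨_, hy, t, ht, rfl⟩

/-- Integrals over the times spent in a cell are interval integrals.  This includes cells that miss
the segment, for which `tStart = tEnd = 0`. -/
theorem setIntegral_cellTimes {E : Type*} [NormedAddCommGroup E] [NormedSpace ℝ E]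
    (x : Fin n → Pt d) (φ : Fin n → ℝ) (P : Fin (p + 1) → Pt d) (i : Fin n) (α : Fin p)
    (f : ℝ → E) :
    ∫ t in cellTimes x φ P i α, f t = ∫ t in (tStart x φ P i α)..(tEnd x φ P i α), f t := by
  by_cases h : (cellTimes x φ P i α).Nonempty
  · have hle : tStart x φ P i α ≤ tEnd x φ P i α :=
      csInf_le (isCompact_cellTimes x φ P i α).bddBelow (tEnd_mem h)
    rw [cellTimes_eq_Icc h, integral_Icc_eq_integral_Ioc, intervalIntegral.integral_of_le hle]
  · rw [not_nonempty_iff_eq_empty] at h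
    have h1 : tStart x φ P i α = 0 := by
      change sInf (cellTimes x φ P i α) = 0
      rw [h, Real.sInf_empty]
    have h2 : tEnd x φ P i α = 0 := by
      change sSup (cellTimes x φ P i α) = 0
      rw [h, Real.sSup_empty]
    rw [h1, h2, h]
    simp

theorem sum_incidence {M : Type*} [AddCommMonoid M] (x : Fin n → Pt d) (φ : Fin n → ℝ)
    (P : Fin (p + 1) → Pt d) (f : Fin n → Fin p → M) :
    ∑ q ∈ incidence x φ P, f q.1 q.2 = ∑ α, ∑ i ∈ meeting x φ P α, f i α := by
  classical
  rw [incidence, Finset.sum_filter, ← Finset.univ_product_univ, Finset.sum_product_right]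
  refine Finset.sum_congr rfl fun α _ => ?_
  rw [← Finset.sum_filter]
  congr 1
  ext i
  simp

theorem sum_meeting_intervalIntegral {E : Type*} [NormedAddCommGroup E] [NormedSpace ℝ E]
    (x : Fin n → Pt d) (φ : Fin n → ℝ) (P : Fin (p + 1) → Pt d) (α : Fin p)
    (f : Fin n → ℝ → E) :
    ∑ i ∈ meeting x φ P α, ∫ t in (tStart x φ P i α)..(tEnd x φ P i α), f i t =
      ∑ i, ∫ t in cellTimes x φ P i α, f i t := by
  rw [← Finset.sum_subset (Finset.subset_univ (meeting x φ P α))]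
  · exact Finset.sum_congr rfl fun i _ => (setIntegral_cellTimes x φ P i α (f i)).symm
  · intro i _ hi
    rw [mem_meeting_iff, not_nonempty_iff_eq_empty] at hi
    simp [hi]

/-! ### Consequences of the genericity hypothesis -/

theorem Generic.subsingleton_tie (hH : Generic x P) (φ : Fin n → ℝ) (α : Fin p) {i j : Fin n}
    (hij : i ≠ j) :
    {t | siteCost x φ i (seg P α t) = siteCost x φ j (seg P α t)}.Subsingleton := by
  intro s hs t ht
  have es := siteCost_sub_siteCost_seg x φ P α i j s
  have et := siteCost_sub_siteCost_seg x φ P α i j t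
  rw [sub_eq_zero.2 hs] at es
  rw [sub_eq_zero.2 ht] at et
  have : 2 * inner ℝ (P α.succ - P α.castSucc) (x i - x j) ≠ 0 :=
    mul_ne_zero two_ne_zero (hH α i j hij)
  exact mul_left_cancel₀ this (by linarith)

theorem Generic.ae_ne (hH : Generic x P) (φ : Fin n → ℝ) (α : Fin p) :
    ∀ᵐ t : ℝ, ∀ i j, i ≠ j → siteCost x φ i (seg P α t) ≠ siteCost x φ j (seg P α t) := by
  refine ae_all_iff.2 fun i => ae_all_iff.2 fun j => ?_
  by_cases hij : i = j
  · exact Eventually.of_forall fun t h => absurd hij h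
  · have h0 : volume {t | siteCost x φ i (seg P α t) = siteCost x φ j (seg P α t)} = 0 :=
      (hH.subsingleton_tie φ α hij).measure_zero _
    filter_upwards [compl_mem_ae_iff.2 h0] with t ht _ using ht

theorem Generic.injective (hH : Generic x P) (α : Fin p) : Function.Injective x := by
  intro i j hij
  by_contra h
  exact hH α i j h (by rw [hij, sub_self, inner_zero_right])

theorem Generic.aedisjoint (hH : Generic x P) (φ : Fin n → ℝ) (α : Fin p) :
    Pairwise (Function.onFun (AEDisjoint volume) fun i => cellTimes x φ P i α) := by
  intro i j hij
  refine ((hH.subsingleton_tie φ α hij).anti ?_).measure_zero _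
  exact fun t ht => le_antisymm (ht.1.2 j) (ht.2.2 i)

theorem iUnion_cellTimes [Nonempty (Fin n)] (x : Fin n → Pt d) (φ : Fin n → ℝ)
    (P : Fin (p + 1) → Pt d) (α : Fin p) : ⋃ i, cellTimes x φ P i α = Icc 0 1 := by
  refine Subset.antisymm (iUnion_subset fun i => cellTimes_subset x φ P i α) fun t ht => ?_
  obtain ⟨i, hi⟩ := exists_mem_laguerre x φ (seg P α t)
  exact mem_iUnion.2 ⟨i, ht, hi⟩

/-- Up to null sets, the cells cut the parameter interval of a segment into disjoint pieces. -/
theorem Generic.sum_restrict_cellTimes [Nonempty (Fin n)] (hH : Generic x P) (φ : Fin n → ℝ)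
    (α : Fin p) :
    ∑ i, (volume : Measure ℝ).restrict (cellTimes x φ P i α) = volume.restrict (Icc 0 1) := by
  rw [← iUnion_cellTimes x φ P α, Measure.restrict_iUnion_ae (hH.aedisjoint φ α)
    fun i => (measurableSet_cellTimes x φ P i α).nullMeasurableSet, Measure.sum_fintype]

theorem Generic.sum_setIntegral_cellTimes [Nonempty (Fin n)] {E : Type*} [NormedAddCommGroup E]
    [NormedSpace ℝ E] (hH : Generic x P) (φ : Fin n → ℝ) (α : Fin p) {f : ℝ → E}
    (hf : Continuous f) :
    ∑ i, ∫ t in cellTimes x φ P i α, f t = ∫ t in Icc (0 : ℝ) 1, f t := by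
  rw [← hH.sum_restrict_cellTimes φ α, integral_finsetSum_measure]
  exact fun i _ => (hf.integrableOn_Icc (a := 0) (b := 1)).mono_set (cellTimes_subset x φ P i α)

theorem eventually_generic (hH : Generic x P) : ∀ᶠ Q in 𝓝 P, Generic x Q := by
  have : ∀ (α : Fin p) (i j : Fin n), ∀ᶠ Q : Fin (p + 1) → Pt d in 𝓝 P,
      i ≠ j → inner ℝ (Q α.succ - Q α.castSucc) (x i - x j) ≠ 0 := by
    intro α i j
    by_cases hij : i = j
    · exact Eventually.of_forall fun _ h => absurd hij h
    · have hc : Continuous fun Q : Fin (p + 1) → Pt d =>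
          inner ℝ (Q α.succ - Q α.castSucc) (x i - x j) := by fun_prop
      filter_upwards [hc.continuousAt.eventually_ne (hH α i j hij)] with Q hQ _ using hQ
  simpa only [Generic, eventually_all] using this

/-! ### Differentiation of the cost integrals along a segment -/

/-- The derivative of `(P, φ) ↦ ‖l^α(t) - x_i‖² - φ_i`, jointly in the nodes and the weights. -/
def costDeriv (x : Fin n → Pt d) (P : Fin (p + 1) → Pt d) (α : Fin p) (i : Fin n) (t : ℝ) :
    ((Fin (p + 1) → Pt d) × (Fin n → ℝ)) →L[ℝ] ℝ :=
  (2 : ℝ) • (innerSL ℝ (seg P α t - x i)) ∘L (segL α t) ∘L ContinuousLinearMap.fst ℝ _ _ -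
    (ContinuousLinearMap.proj (R := ℝ) (φ := fun _ : Fin n => ℝ) i) ∘L
      ContinuousLinearMap.snd ℝ _ _

theorem continuous_costDeriv (x : Fin n → Pt d) (P : Fin (p + 1) → Pt d) (α : Fin p) (i : Fin n) :
    Continuous (costDeriv x P α i) := by
  unfold costDeriv segL
  fun_prop

theorem hasFDerivAt_siteCost_seg (x : Fin n → Pt d) (α : Fin p) (i : Fin n) (t : ℝ)
    (Q : (Fin (p + 1) → Pt d) × (Fin n → ℝ)) :
    HasFDerivAt (fun Q : (Fin (p + 1) → Pt d) × (Fin n → ℝ) => siteCost x Q.2 i (seg Q.1 α t))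
      (costDeriv x Q.1 α i t) Q := by
  have h1 : HasFDerivAt (fun Q : (Fin (p + 1) → Pt d) × (Fin n → ℝ) => seg Q.1 α t - x i)
      (segL α t ∘L ContinuousLinearMap.fst ℝ _ _) Q :=
    ((segL α t ∘L ContinuousLinearMap.fst ℝ _ (Fin n → ℝ)).hasFDerivAt (x := Q)).sub_const _
  have h2 : HasFDerivAt (fun Q : (Fin (p + 1) → Pt d) × (Fin n → ℝ) => Q.2 i)
      ((ContinuousLinearMap.proj (R := ℝ) (φ := fun _ : Fin n => ℝ) i) ∘L
        ContinuousLinearMap.snd ℝ _ _) Q :=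
    ((ContinuousLinearMap.proj (R := ℝ) (φ := fun _ : Fin n => ℝ) i) ∘L
        ContinuousLinearMap.snd ℝ (Fin (p + 1) → Pt d) _).hasFDerivAt
  have h3 := h1.norm_sq.sub h2
  rw [← Nat.cast_smul_eq_nsmul ℝ 2, Nat.cast_ofNat] at h3
  exact h3

/-- A local Lipschitz constant of the costs, uniform in `t ∈ [0, 1]` and in the site. -/
theorem abs_siteCost_seg_sub_le (x : Fin n → Pt d) (α : Fin p) (i : Fin n) {t : ℝ}
    (ht : t ∈ Icc (0 : ℝ) 1) {Q Q₀ : (Fin (p + 1) → Pt d) × (Fin n → ℝ)}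
    (hQ : Q ∈ Metric.ball Q₀ 1) :
    |siteCost x Q.2 i (seg Q.1 α t) - siteCost x Q₀.2 i (seg Q₀.1 α t)| ≤
      (2 * ‖Q₀‖ + 2 + 2 * ‖x‖) * ‖Q - Q₀‖ := by
  have hQ1 : ‖Q - Q₀‖ < 1 := by rwa [← mem_ball_iff_norm]
  have hQ2 : ‖Q‖ ≤ ‖Q₀‖ + 1 := by linarith [norm_le_norm_add_norm_sub Q₀ Q, norm_sub_rev Q Q₀]
  have hab : ‖seg Q.1 α t - seg Q₀.1 α t‖ ≤ ‖Q - Q₀‖ := by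
    rw [← seg_sub]
    exact (norm_seg_le _ α ht).trans (norm_fst_le (Q - Q₀))
  have ha : ‖seg Q.1 α t‖ ≤ ‖Q‖ := (norm_seg_le _ α ht).trans (norm_fst_le Q)
  have hb : ‖seg Q₀.1 α t‖ ≤ ‖Q₀‖ := (norm_seg_le _ α ht).trans (norm_fst_le Q₀)
  have hx : ‖x i‖ ≤ ‖x‖ := norm_le_pi_norm x i
  have hφ : |Q.2 i - Q₀.2 i| ≤ ‖Q - Q₀‖ :=
    (norm_le_pi_norm (Q - Q₀).2 i).trans (norm_snd_le (Q - Q₀))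
  generalize seg Q.1 α t = a at *
  generalize seg Q₀.1 α t = b at *
  have hsq : ‖a - x i‖ ^ 2 - ‖b - x i‖ ^ 2 =
      (‖a - x i‖ - ‖b - x i‖) * (‖a - x i‖ + ‖b - x i‖) := by ring
  have h1 : |‖a - x i‖ - ‖b - x i‖| ≤ ‖Q - Q₀‖ := by
    refine (abs_norm_sub_norm_le _ _).trans ?_
    rwa [sub_sub_sub_cancel_right]
  have h2 : |‖a - x i‖ + ‖b - x i‖| ≤ 2 * ‖Q₀‖ + 1 + 2 * ‖x‖ := by
    rw [abs_of_nonneg (by positivity)]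
    linarith [norm_sub_le a (x i), norm_sub_le b (x i)]
  have h3 : |‖a - x i‖ ^ 2 - ‖b - x i‖ ^ 2| ≤ ‖Q - Q₀‖ * (2 * ‖Q₀‖ + 1 + 2 * ‖x‖) := by
    rw [hsq, abs_mul]
    exact mul_le_mul h1 h2 (abs_nonneg _) (norm_nonneg _)
  calc |siteCost x Q.2 i a - siteCost x Q₀.2 i b|
      = |(‖a - x i‖ ^ 2 - ‖b - x i‖ ^ 2) - (Q.2 i - Q₀.2 i)| := by
        unfold siteCost; congr 1; ring
    _ ≤ |‖a - x i‖ ^ 2 - ‖b - x i‖ ^ 2| + |Q.2 i - Q₀.2 i| := abs_sub _ _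
    _ ≤ (2 * ‖Q₀‖ + 2 + 2 * ‖x‖) * ‖Q - Q₀‖ := by linarith

theorem abs_minCost_seg_sub_le [Nonempty (Fin n)] (x : Fin n → Pt d) (α : Fin p) {t : ℝ}
    (ht : t ∈ Icc (0 : ℝ) 1) {Q Q₀ : (Fin (p + 1) → Pt d) × (Fin n → ℝ)}
    (hQ : Q ∈ Metric.ball Q₀ 1) :
    |minCost x Q.2 (seg Q.1 α t) - minCost x Q₀.2 (seg Q₀.1 α t)| ≤
      (2 * ‖Q₀‖ + 2 + 2 * ‖x‖) * ‖Q - Q₀‖ := by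
  obtain ⟨i, hi⟩ := exists_minCost_eq x Q.2 (seg Q.1 α t)
  obtain ⟨j, hj⟩ := exists_minCost_eq x Q₀.2 (seg Q₀.1 α t)
  have h1 := minCost_le x Q.2 j (seg Q.1 α t)
  have h2 := minCost_le x Q₀.2 i (seg Q₀.1 α t)
  have h3 := abs_le.1 (abs_siteCost_seg_sub_le x α i ht hQ)
  have h4 := abs_le.1 (abs_siteCost_seg_sub_le x α j ht hQ)
  rw [abs_le]
  constructor <;> linarith [h3.1, h3.2, h4.1, h4.2]

/-- Differentiation of the cost of sending a fixed set of times to a fixed site. -/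
theorem hasFDerivAt_setIntegral_siteCost (x : Fin n → Pt d) (α : Fin p) (i : Fin n) {T : Set ℝ}
    (hT : T ⊆ Icc 0 1) (hTm : MeasurableSet T) (Q : (Fin (p + 1) → Pt d) × (Fin n → ℝ)) :
    HasFDerivAt (fun Q : (Fin (p + 1) → Pt d) × (Fin n → ℝ) =>
        ∫ t in T, siteCost x Q.2 i (seg Q.1 α t))
      (∫ t in T, costDeriv x Q.1 α i t) Q := by
  have hfin : IsFiniteMeasure ((volume : Measure ℝ).restrict T) :=
    isFiniteMeasure_restrict.2 ((measure_mono hT).trans_lt measure_Icc_lt_top).ne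
  have hint : ∀ Q : (Fin (p + 1) → Pt d) × (Fin n → ℝ),
      Integrable (fun t => siteCost x Q.2 i (seg Q.1 α t)) (volume.restrict T) := fun Q =>
    (Continuous.integrableOn_Icc (a := 0) (b := 1) (by fun_prop)).mono_set hT
  refine (hasFDerivAt_integral_of_dominated_loc_of_lip'
    (bound := fun _ => 2 * ‖Q‖ + 2 + 2 * ‖x‖) (Metric.ball_mem_nhds Q one_pos)
    (fun Q' _ => (hint Q').aestronglyMeasurable) (hint Q)
    (continuous_costDeriv x Q.1 α i).aestronglyMeasurable ?_ (integrable_const _) ?_).2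
  · filter_upwards [ae_restrict_mem hTm] with t ht Q' hQ'
    exact abs_siteCost_seg_sub_le x α i (hT ht) hQ'
  · exact Eventually.of_forall fun t => hasFDerivAt_siteCost_seg x α i t Q

/-- The integral `∫₀¹ minᵢ (‖l^α(t) - x_i‖² - φ_i) dt` as a function of the nodes and the weights. -/
def segMin [Nonempty (Fin n)] (x : Fin n → Pt d) (α : Fin p)
    (Q : (Fin (p + 1) → Pt d) × (Fin n → ℝ)) : ℝ :=
  ∫ t in Icc (0 : ℝ) 1, minCost x Q.2 (seg Q.1 α t)

/-- Where the minimizing site is unique, the minimum is locally equal to the cost of that site, so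
that it has the same derivative. -/
theorem hasFDerivAt_minCost_seg [Nonempty (Fin n)] {α : Fin p} {t : ℝ}
    {Q : (Fin (p + 1) → Pt d) × (Fin n → ℝ)}
    (hne : ∀ i j, i ≠ j → siteCost x Q.2 i (seg Q.1 α t) ≠ siteCost x Q.2 j (seg Q.1 α t))
    (ht : t ∈ Icc (0 : ℝ) 1) :
    HasFDerivAt
      (fun Q : (Fin (p + 1) → Pt d) × (Fin n → ℝ) => minCost x Q.2 (seg Q.1 α t))
      (∑ i, (cellTimes x Q.2 Q.1 i α).indicator (costDeriv x Q.1 α i) t) Q := by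
  obtain ⟨i, hi⟩ := exists_mem_laguerre x Q.2 (seg Q.1 α t)
  have hlt : ∀ j, j ≠ i → siteCost x Q.2 i (seg Q.1 α t) < siteCost x Q.2 j (seg Q.1 α t) :=
    fun j hj => lt_of_le_of_ne (hi j) (hne i j hj.symm)
  have hsum : ∑ j, (cellTimes x Q.2 Q.1 j α).indicator (costDeriv x Q.1 α j) t =
      costDeriv x Q.1 α i t := by
    rw [Finset.sum_eq_single i, indicator_of_mem (show t ∈ cellTimes x Q.2 Q.1 i α from ⟨ht, hi⟩)]
    · intro j _ hj
      exact indicator_of_notMem (fun hmem => absurd (hmem.2 i) (not_le.2 (hlt j hj))) _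
    · exact fun h => absurd (Finset.mem_univ i) h
  rw [hsum]
  refine (hasFDerivAt_siteCost_seg x α i t Q).congr_of_eventuallyEq ?_
  have hev : ∀ᶠ Q' : (Fin (p + 1) → Pt d) × (Fin n → ℝ) in 𝓝 Q,
      ∀ j, siteCost x Q'.2 i (seg Q'.1 α t) ≤ siteCost x Q'.2 j (seg Q'.1 α t) := by
    rw [eventually_all]
    intro j
    by_cases hj : j = i
    · subst hj; exact Eventually.of_forall fun _ => le_rfl
    · exact ((hasFDerivAt_siteCost_seg x α i t Q).continuousAt.eventually_lt
        (hasFDerivAt_siteCost_seg x α j t Q).continuousAt (hlt j hj)).mono fun _ h => h.le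
  filter_upwards [hev] with Q' hQ'
  exact le_antisymm (minCost_le _ _ _ _) (le_minCost hQ')

theorem integral_sum_indicator {E ι : Type*} [NormedAddCommGroup E] [NormedSpace ℝ E] [Fintype ι]
    {D : ι → ℝ → E} {T : ι → Set ℝ} (hD : ∀ i, Continuous (D i)) (hTm : ∀ i, MeasurableSet (T i))
    (hT : ∀ i, T i ⊆ Icc 0 1) :
    AEStronglyMeasurable (fun t => ∑ i, (T i).indicator (D i) t)
        (volume.restrict (Icc (0 : ℝ) 1)) ∧
      ∫ t in Icc (0 : ℝ) 1, ∑ i, (T i).indicator (D i) t = ∑ i, ∫ t in T i, D i t := by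
  have hind : ∀ i ∈ Finset.univ,
      Integrable ((T i).indicator (D i)) (volume.restrict (Icc (0 : ℝ) 1)) :=
    fun i _ => ((hD i).integrableOn_Icc).indicator (hTm i)
  refine ⟨(integrable_finsetSum _ hind).aestronglyMeasurable, ?_⟩
  rw [integral_finsetSum _ hind]
  simp only [setIntegral_indicator (hTm _), inter_eq_self_of_subset_right (hT _)]

/-- Differentiation under the integral sign when the parameter interval is cut into pieces `T i`, on
each of which the derivative of the integrand is a continuous function `D i` of the time. -/
theorem hasFDerivAt_integral_of_pieces {H ι : Type*} [NormedAddCommGroup H] [NormedSpace ℝ H]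
    [Fintype ι] {f : H → ℝ → ℝ} {D : ι → ℝ → H →L[ℝ] ℝ} {T : ι → Set ℝ} {K : ℝ} {z : H}
    (hf : ∀ w, Continuous (f w)) (hD : ∀ i, Continuous (D i)) (hTm : ∀ i, MeasurableSet (T i))
    (hT : ∀ i, T i ⊆ Icc 0 1)
    (hlip : ∀ t ∈ Icc (0 : ℝ) 1, ∀ w ∈ Metric.ball z 1, |f w t - f z t| ≤ K * ‖w - z‖)
    (hdiff : ∀ᵐ t ∂(volume.restrict (Icc (0 : ℝ) 1)),
      HasFDerivAt (fun w => f w t) (∑ i, (T i).indicator (D i) t) z) :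
    HasFDerivAt (fun w => ∫ t in Icc (0 : ℝ) 1, f w t) (∑ i, ∫ t in T i, D i t) z := by
  have hint : ∀ w, Integrable (f w) (volume.restrict (Icc (0 : ℝ) 1)) :=
    fun w => (hf w).integrableOn_Icc
  obtain ⟨hmeas, hsum⟩ := integral_sum_indicator hD hTm hT
  rw [← hsum]
  exact (hasFDerivAt_integral_of_dominated_loc_of_lip' (Metric.ball_mem_nhds z one_pos)
    (fun w _ => (hint w).aestronglyMeasurable) (hint z) hmeas
    ((ae_restrict_mem measurableSet_Icc).mono hlip) (integrable_const _) hdiff).2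

theorem Generic.hasFDerivAt_segMin [Nonempty (Fin n)] (hH : Generic x P) (φ : Fin n → ℝ)
    (α : Fin p) :
    HasFDerivAt (segMin x α) (∑ i, ∫ t in cellTimes x φ P i α, costDeriv x P α i t) (P, φ) := by
  refine hasFDerivAt_integral_of_pieces (K := 2 * ‖(P, φ)‖ + 2 + 2 * ‖x‖) (fun Q => by fun_prop)
    (continuous_costDeriv x P α) (fun i => measurableSet_cellTimes x φ P i α)
    (fun i => cellTimes_subset x φ P i α)
    (fun t ht Q hQ => abs_minCost_seg_sub_le x α ht hQ) ?_
  filter_upwards [ae_restrict_mem measurableSet_Icc, ae_restrict_of_ae (hH.ae_ne φ α)]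
    with t ht hne
  exact hasFDerivAt_minCost_seg (Q := (P, φ)) hne ht

/-! ### The dual functional as a minimum of costs -/

theorem integral_polyline (hρ : ∀ α, 0 ≤ ρ α) (P : Fin (p + 1) → Pt d) {f : Pt d → ℝ}
    (hf : Measurable f)
    (hint : ∀ α, IntegrableOn (fun t => f (seg P α t)) (Icc (0 : ℝ) 1)) :
    ∫ y, f y ∂(polyline P ρ) = ∑ α, ρ α * ∫ t in Icc (0 : ℝ) 1, f (seg P α t) := by
  have hm : ∀ α, AEMeasurable (seg P α) (volume.restrict (Icc (0 : ℝ) 1)) := fun α =>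
    (continuous_seg P α).aemeasurable
  rw [polyline, integral_finsetSum_measure]
  · refine Finset.sum_congr rfl fun α _ => ?_
    rw [integral_smul_measure, integral_map (hm α) hf.aestronglyMeasurable,
      ENNReal.toReal_ofReal (hρ α), smul_eq_mul]
  · intro α _
    refine Integrable.smul_measure ?_ ENNReal.ofReal_ne_top
    exact (integrable_map_measure hf.aestronglyMeasurable (hm α)).2 (hint α)

theorem Generic.dual_eq_sum_segMin [Nonempty (Fin n)] (hH : Generic x P) (hρ : ∀ α, 0 ≤ ρ α)
    (m φ : Fin n → ℝ) :
    dual x m φ P ρ = ∑ α, ρ α * segMin x α (P, φ) + ∑ i, m i * φ i := by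
  have hcell : ∀ i, ∫ y in laguerre x φ i, (‖y - x i‖ ^ 2 - φ i) ∂(polyline P ρ) =
      ∑ α, ρ α * ∫ t in cellTimes x φ P i α, minCost x φ (seg P α t) := by
    intro i
    have hL : MeasurableSet (laguerre x φ i) := (isClosed_laguerre x φ i).measurableSet
    have hc : ∀ α : Fin p, (fun t => (laguerre x φ i).indicator (siteCost x φ i) (seg P α t)) =
        (seg P α ⁻¹' laguerre x φ i).indicator fun t => siteCost x φ i (seg P α t) := fun α => rfl
    have hmeas : ∀ α : Fin p, MeasurableSet (seg P α ⁻¹' laguerre x φ i) := fun α =>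
      hL.preimage (continuous_seg P α).measurable
    change ∫ y in laguerre x φ i, siteCost x φ i y ∂(polyline P ρ) = _
    rw [← integral_indicator hL, integral_polyline hρ P
      ((continuous_siteCost x φ i).measurable.indicator hL)]
    · refine Finset.sum_congr rfl fun α _ => ?_
      rw [hc, setIntegral_indicator (hmeas α)]
      congr 1
      exact setIntegral_congr_fun (measurableSet_cellTimes x φ P i α) fun t ht =>
        (minCost_eq_of_mem ht.2).symm
    · intro α
      rw [hc]
      exact (Continuous.integrableOn_Icc (by fun_prop)).indicator (hmeas α)
  unfold dual
  simp only [hcell]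
  rw [Finset.sum_comm]
  simp only [← Finset.mul_sum]
  congr 1
  refine Finset.sum_congr rfl fun α _ => ?_
  rw [hH.sum_setIntegral_cellTimes φ α (f := fun t => minCost x φ (seg P α t)) (by fun_prop)]
  rfl

/-! ### Maximizers of the dual functional -/

theorem integral_costDeriv_apply (x : Fin n → Pt d) (φ : Fin n → ℝ) (P : Fin (p + 1) → Pt d)
    (α : Fin p) (i : Fin n) (u : (Fin (p + 1) → Pt d) × (Fin n → ℝ)) :
    (∫ t in cellTimes x φ P i α, costDeriv x P α i t) u =
      ∫ t in cellTimes x φ P i α, (2 * inner ℝ (seg P α t - x i) (seg u.1 α t) - u.2 i) := by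
  rw [ContinuousLinearMap.integral_apply]
  · rfl
  · exact ((continuous_costDeriv x P α i).integrableOn_Icc (a := 0) (b := 1)).mono_set
      (cellTimes_subset x φ P i α)

theorem Generic.hasFDerivAt_dual_weights [Nonempty (Fin n)] (hH : Generic x P)
    (hρ : ∀ α, 0 ≤ ρ α) (m φ : Fin n → ℝ) :
    HasFDerivAt (fun ψ => dual x m ψ P ρ)
      (∑ α, ρ α • ((∑ i, ∫ t in cellTimes x φ P i α, costDeriv x P α i t) ∘L
          ContinuousLinearMap.inr ℝ (Fin (p + 1) → Pt d) (Fin n → ℝ)) +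
        ∑ i, m i • ContinuousLinearMap.proj (R := ℝ) (φ := fun _ : Fin n => ℝ) i) φ := by
  simp only [hH.dual_eq_sum_segMin hρ]
  refine HasFDerivAt.add (HasFDerivAt.fun_sum fun α _ => ?_) (HasFDerivAt.fun_sum fun i _ => ?_)
  · exact ((hH.hasFDerivAt_segMin φ α).comp φ (hasFDerivAt_prodMk_right P φ)).const_mul (ρ α)
  · exact ((ContinuousLinearMap.proj (R := ℝ) (φ := fun _ : Fin n => ℝ) i).hasFDerivAt).const_mul
      (m i)

/-- First-order optimality in the weights: the `i`-th cell of a maximizer has mass `m i`. -/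
theorem IsOptimal.sum_cellTimes [Nonempty (Fin n)] (hφ : IsOptimal x m P ρ φ) (hH : Generic x P)
    (hρ : ∀ α, 0 ≤ ρ α) (i : Fin n) :
    ∑ α, ρ α * volume.real (cellTimes x φ P i α) = m i := by
  have h0 := (show IsLocalMax (fun ψ => dual x m ψ P ρ) φ from
    Eventually.of_forall hφ).hasFDerivAt_eq_zero (hH.hasFDerivAt_dual_weights hρ m φ)
  have h1 := DFunLike.congr_fun h0 (Pi.single i 1)
  have hα : ∀ α, (∑ j, ∫ t in cellTimes x φ P j α, costDeriv x P α j t)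
      ((0 : Fin (p + 1) → Pt d), (Pi.single i 1 : Fin n → ℝ)) =
        - volume.real (cellTimes x φ P i α) := by
    intro α
    rw [_root_.sum_apply, Finset.sum_eq_single i]
    · rw [integral_costDeriv_apply]
      simp [seg]
    · intro j _ hj
      rw [integral_costDeriv_apply]
      simp [seg, hj]
    · exact fun h => absurd (Finset.mem_univ i) h
  simp only [_root_.add_apply, _root_.sum_apply,
    _root_.smul_apply, ContinuousLinearMap.comp_apply, ContinuousLinearMap.inr_apply,
    ContinuousLinearMap.proj_apply, _root_.zero_apply, smul_eq_mul] at h1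
  simp only [_root_.sum_apply] at hα
  simp only [hα, Pi.single_apply, mul_neg, Finset.sum_neg_distrib, mul_ite, mul_one, mul_zero,
    Finset.sum_ite_eq', Finset.mem_univ, if_true] at h1
  linarith

/-- Existence of maximizers.  The functional is invariant under a common shift of the weights, and
a weight far below the largest one can be raised without loss, since its cell does not meet the
polyline.  Hence the supremum is attained on a cube. -/
theorem Generic.exists_isOptimal [Nonempty (Fin n)] (hH : Generic x P) (hρ : ∀ α, 0 ≤ ρ α)
    (hρ1 : ∑ α, ρ α = 1) (hm : ∀ i, 0 ≤ m i) (hm1 : ∑ i, m i = 1) :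
    ∃ φ, IsOptimal x m P ρ φ := by
  set D : ℝ := (‖P‖ + ‖x‖) ^ 2 with hD
  have hD0 : 0 ≤ D := sq_nonneg _
  obtain ⟨φ, -, hφ⟩ := (isCompact_Icc (a := fun _ : Fin n => -D) (b := fun _ => 0)).exists_isMaxOn
    ⟨fun _ => 0, fun _ => by simpa using hD0, le_rfl⟩
    (f := fun ψ => dual x m ψ P ρ) fun ψ _ =>
      (hH.hasFDerivAt_dual_weights hρ m ψ).continuousAt.continuousWithinAt
  refine ⟨φ, fun ψ => ?_⟩
  obtain ⟨k, hk⟩ := Finite.exists_max ψ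
  have hχ : (fun i => max (ψ i - ψ k) (-D)) ∈ Icc (fun _ : Fin n => -D) (fun _ => 0) :=
    ⟨fun i => le_max_right _ _, fun i => max_le (by linarith [hk i]) (by linarith)⟩
  refine le_trans ?_ (hφ hχ)
  generalize hχ' : (fun i => max (ψ i - ψ k) (-D)) = χ
  have hχi : ∀ i, χ i = max (ψ i - ψ k) (-D) := fun i => by rw [← hχ']
  have hpt : ∀ α, ∀ t ∈ Icc (0 : ℝ) 1,
      minCost x ψ (seg P α t) ≤ minCost x χ (seg P α t) - ψ k := by
    intro α t ht
    have hdist : ‖seg P α t - x k‖ ^ 2 ≤ D := by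
      refine pow_le_pow_left₀ (norm_nonneg _) ?_ 2
      exact (norm_sub_le _ _).trans (add_le_add (norm_seg_le P α ht) (norm_le_pi_norm x k))
    rw [le_sub_iff_add_le]
    refine le_minCost fun i => ?_
    unfold siteCost
    rw [hχi]
    rcases max_cases (ψ i - ψ k) (-D) with h | h <;> rw [h.1]
    · have := minCost_le x ψ i (seg P α t)
      unfold siteCost at this
      linarith
    · have := minCost_le x ψ k (seg P α t)
      unfold siteCost at this
      linarith [sq_nonneg ‖seg P α t - x i‖]
  have hseg : ∀ α, segMin x α (P, ψ) ≤ segMin x α (P, χ) - ψ k := by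
    intro α
    have hi : ∀ χ, IntegrableOn (fun t => minCost x χ (seg P α t)) (Icc (0 : ℝ) 1) :=
      fun χ => Continuous.integrableOn_Icc (by fun_prop)
    have h := setIntegral_mono_on (hi ψ) ((hi χ).sub (integrable_const (ψ k))) measurableSet_Icc
      (hpt α)
    have h2 := integral_sub (hi χ) (integrable_const (ψ k))
    simp only [Pi.sub_apply] at h
    rw [h2] at h
    simpa [segMin] using h
  have hsum : ∑ i, m i * ψ i ≤ ∑ i, m i * χ i + ψ k := by
    calc ∑ i, m i * ψ i ≤ ∑ i, (m i * χ i + m i * ψ k) := by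
          refine Finset.sum_le_sum fun i _ => ?_
          rw [← mul_add]
          refine mul_le_mul_of_nonneg_left ?_ (hm i)
          rw [hχi]
          linarith [le_max_left (ψ i - ψ k) (-D)]
      _ = ∑ i, m i * χ i + ψ k := by
          rw [Finset.sum_add_distrib, ← Finset.sum_mul, hm1, one_mul]
  have hsum2 : ∑ α, ρ α * segMin x α (P, ψ) ≤ ∑ α, ρ α * segMin x α (P, χ) - ψ k := by
    calc ∑ α, ρ α * segMin x α (P, ψ) ≤ ∑ α, (ρ α * segMin x α (P, χ) - ρ α * ψ k) := by
          refine Finset.sum_le_sum fun α _ => ?_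
          rw [← mul_sub]
          exact mul_le_mul_of_nonneg_left (hseg α) (hρ α)
      _ = ∑ α, ρ α * segMin x α (P, χ) - ψ k := by
          rw [Finset.sum_sub_distrib, ← Finset.sum_mul, hρ1, one_mul]
  change dual x m ψ P ρ ≤ dual x m χ P ρ
  rw [hH.dual_eq_sum_segMin hρ, hH.dual_eq_sum_segMin hρ]
  linarith

/-! ### Kantorovich duality -/

/-- The value of the Kantorovich problem in `[0, ∞]`, whose real part is `W2sq`. -/
def kantorovichValue (μ ν : Measure (Pt d)) : ℝ≥0∞ :=
  ⨅ (γ : Measure (Pt d × Pt d)) (_ : IsCoupling μ ν γ), ∫⁻ q, ‖q.1 - q.2‖ₑ ^ 2 ∂γ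

theorem W2sq_eq_toReal (μ ν : Measure (Pt d)) : W2sq μ ν = (kantorovichValue μ ν).toReal := rfl

theorem ofReal_norm_sq (v : Pt d) : ENNReal.ofReal (‖v‖ ^ 2) = ‖v‖ₑ ^ 2 := by
  rw [ENNReal.ofReal_pow (norm_nonneg _), ofReal_norm]

theorem integrable_polyline (P : Fin (p + 1) → Pt d) (ρ : Fin p → ℝ) {f : Pt d → ℝ}
    (hf : Continuous f) : Integrable f (polyline P ρ) := by
  rw [polyline, integrable_finsetSum_measure]
  intro α _
  refine Integrable.smul_measure ?_ ENNReal.ofReal_ne_top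
  refine (integrable_map_measure hf.aestronglyMeasurable (continuous_seg P α).aemeasurable).2 ?_
  exact (hf.comp (continuous_seg P α)).integrableOn_Icc

instance (P : Fin (p + 1) → Pt d) (ρ : Fin p → ℝ) : IsFiniteMeasure (polyline P ρ) :=
  ((integrable_const_iff_isFiniteMeasure (one_ne_zero' ℝ)).1
    (integrable_polyline P ρ continuous_const))

/-- A coupling whose first marginal is atomic is concentrated on the sites in the first variable. -/
theorem ae_fst_mem_range {γ : Measure (Pt d × Pt d)} (h : γ.map Prod.fst = atomic x m) :
    ∀ᵐ q ∂γ, ∃ i, q.1 = x i := by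
  have hμ : ∀ᵐ y ∂(atomic x m), y ∈ range x := by
    rw [ae_iff, atomic, Measure.finsetSum_apply]
    refine Finset.sum_eq_zero fun i _ => ?_
    have hms : MeasurableSet {a | ¬a ∈ range x} := (finite_range x).measurableSet.compl
    rw [Measure.smul_apply, Measure.dirac_apply' _ hms]
    simp
  rw [← h] at hμ
  filter_upwards [ae_of_ae_map measurable_fst.aemeasurable hμ] with q hq
  obtain ⟨i, hi⟩ := hq
  exact ⟨i, hi.symm⟩

/-- Weak duality: the dual functional is a lower bound for the cost of every coupling. -/
theorem Generic.ofReal_dual_le_lintegral [Nonempty (Fin n)] (hH : Generic x P)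
    (hx : Function.Injective x) (hρ : ∀ α, 0 ≤ ρ α) (hm : ∀ i, 0 ≤ m i) (ψ : Fin n → ℝ)
    {γ : Measure (Pt d × Pt d)} (hγ : IsCoupling (atomic x m) (polyline P ρ) γ) :
    ENNReal.ofReal (dual x m ψ P ρ) ≤ ∫⁻ q, ‖q.1 - q.2‖ₑ ^ 2 ∂γ := by
  obtain ⟨hγ1, hγ2⟩ := hγ
  by_cases htop : ∫⁻ q, ‖q.1 - q.2‖ₑ ^ 2 ∂γ = ⊤
  · rw [htop]; exact le_top
  have hγfin : IsFiniteMeasure γ := by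
    refine ⟨?_⟩
    have h := measure_lt_top (polyline P ρ) univ
    rwa [← hγ2, Measure.map_apply measurable_snd MeasurableSet.univ, preimage_univ] at h
  have hcost : Integrable (fun q : Pt d × Pt d => ‖q.1 - q.2‖ ^ 2) γ := by
    refine ⟨(by fun_prop : Continuous fun q : Pt d × Pt d => ‖q.1 - q.2‖ ^ 2).aestronglyMeasurable,
      ?_⟩
    rw [hasFiniteIntegral_iff_ofReal (Eventually.of_forall fun q => sq_nonneg _)]
    simp only [ofReal_norm_sq]
    exact lt_of_le_of_ne le_top htop
  -- a potential on the whole space with the value `ψ i` at the `i`-th site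
  let Ψ : Pt d → ℝ := fun y => ∑ i, ({x i} : Set (Pt d)).indicator (fun _ => ψ i) y
  have hΨ : ∀ i, Ψ (x i) = ψ i := by
    intro i
    refine (Finset.sum_eq_single i (fun j _ hj => ?_) fun h => absurd (Finset.mem_univ i) h).trans
      (indicator_of_mem (mem_singleton _) _)
    exact indicator_of_notMem (fun h => hj (hx (mem_singleton_iff.1 h)).symm) _
  have hΨm : Measurable Ψ :=
    Finset.measurable_fun_sum _ fun i _ => measurable_const.indicator (measurableSet_singleton _)
  have hΨi : ∀ (κ : Measure (Pt d)) [IsFiniteMeasure κ], Integrable Ψ κ := fun κ _ =>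
    integrable_finsetSum _ fun i _ => (integrable_const _).indicator (measurableSet_singleton _)
  have hΨγ : Integrable (fun q : Pt d × Pt d => Ψ q.1) γ :=
    (integrable_map_measure hΨm.aestronglyMeasurable measurable_fst.aemeasurable).1 (hΨi _)
  have hcγ : Integrable (fun q : Pt d × Pt d => minCost x ψ q.2) γ := by
    refine (integrable_map_measure (continuous_minCost x ψ).aestronglyMeasurable
      measurable_snd.aemeasurable).1 ?_
    rw [hγ2]
    exact integrable_polyline P ρ (continuous_minCost x ψ)
  have hΨint : ∫ q, Ψ q.1 ∂γ = ∑ i, m i * ψ i := by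
    rw [← integral_map measurable_fst.aemeasurable hΨm.aestronglyMeasurable, hγ1, atomic,
      integral_finsetSum_measure fun i _ => (hΨi _).smul_measure ENNReal.ofReal_ne_top]
    refine Finset.sum_congr rfl fun i _ => ?_
    rw [integral_smul_measure, integral_dirac, hΨ, ENNReal.toReal_ofReal (hm i), smul_eq_mul]
  have hcint : ∫ q, minCost x ψ q.2 ∂γ = ∑ α, ρ α * segMin x α (P, ψ) := by
    rw [← integral_map measurable_snd.aemeasurable
      (continuous_minCost x ψ).aestronglyMeasurable, hγ2]
    exact integral_polyline hρ P (continuous_minCost x ψ).measurable fun α =>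
      Continuous.integrableOn_Icc (by fun_prop)
  have hle : dual x m ψ P ρ ≤ ∫ q, ‖q.1 - q.2‖ ^ 2 ∂γ := by
    rw [hH.dual_eq_sum_segMin hρ, ← hΨint, ← hcint, ← integral_add hcγ hΨγ]
    refine integral_mono_ae (hcγ.add hΨγ) hcost ?_
    filter_upwards [ae_fst_mem_range hγ1] with q ⟨i, hi⟩
    have := minCost_le x ψ i q.2
    unfold siteCost at this
    rw [hi, hΨ, norm_sub_rev]
    linarith
  refine (ENNReal.ofReal_le_ofReal hle).trans_eq ?_
  rw [ofReal_integral_eq_lintegral_ofReal hcost (Eventually.of_forall fun q => sq_nonneg _)]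
  simp only [ofReal_norm_sq]

/-- The plan that sends a time `t` of the `α`-th segment to the site whose cell at the nodes `P`
contains `l^α(t)`, with the segments themselves placed at the nodes `Q`. -/
def cellPlan (x : Fin n → Pt d) (φ : Fin n → ℝ) (P Q : Fin (p + 1) → Pt d) (ρ : Fin p → ℝ) :
    Measure (Pt d × Pt d) :=
  ∑ α, ∑ i, ENNReal.ofReal (ρ α) •
    (volume.restrict (cellTimes x φ P i α)).map fun t => (x i, seg Q α t)

/-- The cost of `cellPlan x φ P Q ρ`. -/
def cellPlanCost (x : Fin n → Pt d) (φ : Fin n → ℝ) (P Q : Fin (p + 1) → Pt d)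
    (ρ : Fin p → ℝ) : ℝ :=
  ∑ α, ρ α * ∑ i, ∫ t in cellTimes x φ P i α, ‖seg Q α t - x i‖ ^ 2

theorem measurable_site_seg (x : Fin n → Pt d) (Q : Fin (p + 1) → Pt d) (i : Fin n) (α : Fin p) :
    Measurable fun t => (x i, seg Q α t) :=
  (by fun_prop : Continuous fun t => (x i, seg Q α t)).measurable

/-- If the cells have the masses `m i` at `P`, then the plan is admissible at every `Q`: moving the
nodes without changing the densities preserves the masses that are sent to the sites. -/
theorem Generic.isCoupling_cellPlan [Nonempty (Fin n)] (hH : Generic x P) (hρ : ∀ α, 0 ≤ ρ α)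
    (hmass : ∀ i, ∑ α, ρ α * volume.real (cellTimes x φ P i α) = m i)
    (Q : Fin (p + 1) → Pt d) :
    IsCoupling (atomic x m) (polyline Q ρ) (cellPlan x φ P Q ρ) := by
  have hmap : ∀ f : Pt d × Pt d → Pt d, Measurable f → (cellPlan x φ P Q ρ).map f =
      ∑ α, ∑ i, ENNReal.ofReal (ρ α) •
        (volume.restrict (cellTimes x φ P i α)).map fun t => f (x i, seg Q α t) := by
    intro f hf
    rw [cellPlan, Measure.map_finset_sum hf.aemeasurable]
    refine Finset.sum_congr rfl fun α _ => ?_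
    rw [Measure.map_finset_sum hf.aemeasurable]
    refine Finset.sum_congr rfl fun i _ => ?_
    rw [Measure.map_smul, Measure.map_map hf (measurable_site_seg x Q i α)]
    rfl
  constructor
  · rw [hmap _ measurable_fst, Finset.sum_comm, atomic]
    refine Finset.sum_congr rfl fun i _ => ?_
    simp only [Measure.map_const, Measure.restrict_apply_univ, smul_smul]
    rw [← Finset.sum_smul, ← hmass i, ENNReal.ofReal_sum_of_nonneg
      fun α _ => mul_nonneg (hρ α) measureReal_nonneg]
    congr 1
    refine Finset.sum_congr rfl fun α _ => ?_
    rw [ENNReal.ofReal_mul (hρ α), ofReal_measureReal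
      (isCompact_cellTimes x φ P i α).measure_lt_top.ne]
  · rw [hmap _ measurable_snd, polyline]
    refine Finset.sum_congr rfl fun α _ => ?_
    rw [← Finset.smul_sum, ← hH.sum_restrict_cellTimes φ α,
      Measure.map_finset_sum (continuous_seg Q α).aemeasurable]

theorem lintegral_cellPlan (hρ : ∀ α, 0 ≤ ρ α) (x : Fin n → Pt d) (φ : Fin n → ℝ)
    (P Q : Fin (p + 1) → Pt d) :
    ∫⁻ q, ‖q.1 - q.2‖ₑ ^ 2 ∂(cellPlan x φ P Q ρ) = ENNReal.ofReal (cellPlanCost x φ P Q ρ) := by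
  have hint : ∀ α i, IntegrableOn (fun t => ‖seg Q α t - x i‖ ^ 2) (cellTimes x φ P i α) :=
    fun α i => (Continuous.integrableOn_Icc (a := 0) (b := 1) (by fun_prop)).mono_set
      (cellTimes_subset x φ P i α)
  have hnn : ∀ α i, 0 ≤ ∫ t in cellTimes x φ P i α, ‖seg Q α t - x i‖ ^ 2 :=
    fun α i => integral_nonneg fun t => sq_nonneg _
  rw [cellPlan, cellPlanCost, lintegral_finsetSum_measure, ENNReal.ofReal_sum_of_nonneg
    fun α _ => mul_nonneg (hρ α) (Finset.sum_nonneg fun i _ => hnn α i)]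
  refine Finset.sum_congr rfl fun α _ => ?_
  rw [lintegral_finsetSum_measure, ENNReal.ofReal_mul (hρ α),
    ENNReal.ofReal_sum_of_nonneg fun i _ => hnn α i, Finset.mul_sum]
  refine Finset.sum_congr rfl fun i _ => ?_
  rw [lintegral_smul_measure, lintegral_map
    (by fun_prop : Continuous fun q : Pt d × Pt d => ‖q.1 - q.2‖ₑ ^ 2).measurable
    (measurable_site_seg x Q i α), smul_eq_mul, ofReal_integral_eq_lintegral_ofReal (hint α i)
    (Eventually.of_forall fun t => sq_nonneg _)]
  simp only [ofReal_norm_sq, enorm_sub_rev (x i)]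

/-- If the cells have the masses `m i`, the plan cost is a dual functional with the minima frozen to
the cells at `P`. -/
theorem cellPlanCost_eq (hmass : ∀ i, ∑ α, ρ α * volume.real (cellTimes x φ P i α) = m i)
    (Q : Fin (p + 1) → Pt d) :
    cellPlanCost x φ P Q ρ =
      ∑ α, ρ α * ∑ i, (∫ t in cellTimes x φ P i α, siteCost x φ i (seg Q α t)) +
        ∑ i, m i * φ i := by
  have hint : ∀ α i, IntegrableOn (fun t => ‖seg Q α t - x i‖ ^ 2) (cellTimes x φ P i α) :=
    fun α i => (Continuous.integrableOn_Icc (a := 0) (b := 1) (by fun_prop)).mono_set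
      (cellTimes_subset x φ P i α)
  have h1 : ∀ α i, ∫ t in cellTimes x φ P i α, siteCost x φ i (seg Q α t) =
      (∫ t in cellTimes x φ P i α, ‖seg Q α t - x i‖ ^ 2) -
        volume.real (cellTimes x φ P i α) * φ i := by
    intro α i
    unfold siteCost
    rw [integral_sub (hint α i) (integrableOn_const
      (isCompact_cellTimes x φ P i α).measure_lt_top.ne), setIntegral_const, smul_eq_mul]
  simp only [h1, Finset.sum_sub_distrib, mul_sub, ← hmass, Finset.sum_mul, cellPlanCost]
  rw [sub_add, eq_comm, sub_eq_self, sub_eq_zero, Finset.sum_comm]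
  refine Finset.sum_congr rfl fun α _ => ?_
  rw [Finset.mul_sum]
  exact Finset.sum_congr rfl fun i _ => by ring

theorem Generic.kantorovichValue_le [Nonempty (Fin n)] (hH : Generic x P) (hρ : ∀ α, 0 ≤ ρ α)
    (hmass : ∀ i, ∑ α, ρ α * volume.real (cellTimes x φ P i α) = m i)
    (Q : Fin (p + 1) → Pt d) :
    kantorovichValue (atomic x m) (polyline Q ρ) ≤ ENNReal.ofReal (cellPlanCost x φ P Q ρ) := by
  rw [← lintegral_cellPlan hρ]
  exact iInf₂_le _ (hH.isCoupling_cellPlan hρ hmass Q)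

theorem Generic.W2sq_le_cellPlanCost [Nonempty (Fin n)] (hH : Generic x P) (hρ : ∀ α, 0 ≤ ρ α)
    (hmass : ∀ i, ∑ α, ρ α * volume.real (cellTimes x φ P i α) = m i)
    (Q : Fin (p + 1) → Pt d) :
    W2sq (atomic x m) (polyline Q ρ) ≤ cellPlanCost x φ P Q ρ := by
  rw [W2sq_eq_toReal]
  refine ENNReal.toReal_le_of_le_ofReal ?_ (hH.kantorovichValue_le hρ hmass Q)
  exact Finset.sum_nonneg fun α _ => mul_nonneg (hρ α)
    (Finset.sum_nonneg fun i _ => integral_nonneg fun t => sq_nonneg _)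

theorem Generic.cellPlanCost_self [Nonempty (Fin n)] (hH : Generic x P) (hρ : ∀ α, 0 ≤ ρ α)
    (hmass : ∀ i, ∑ α, ρ α * volume.real (cellTimes x φ P i α) = m i) :
    cellPlanCost x φ P P ρ = dual x m φ P ρ := by
  rw [cellPlanCost_eq hmass, hH.dual_eq_sum_segMin hρ]
  congr 1
  refine Finset.sum_congr rfl fun α _ => ?_
  rw [segMin, ← hH.sum_setIntegral_cellTimes φ α (f := fun t => minCost x φ (seg P α t))
    (by fun_prop)]
  congr 1
  refine Finset.sum_congr rfl fun i _ => ?_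
  exact setIntegral_congr_fun (measurableSet_cellTimes x φ P i α) fun t ht =>
    (minCost_eq_of_mem ht.2).symm

/-- Weak duality for `W2sq`. -/
theorem Generic.dual_le_W2sq [Nonempty (Fin n)] (hH : Generic x P)
    (hx : Function.Injective x) (hρ : ∀ α, 0 ≤ ρ α) (hρ1 : ∑ α, ρ α = 1) (hm : ∀ i, 0 ≤ m i)
    (hm1 : ∑ i, m i = 1) (ψ : Fin n → ℝ) :
    dual x m ψ P ρ ≤ W2sq (atomic x m) (polyline P ρ) := by
  obtain ⟨φ, hφ⟩ := hH.exists_isOptimal hρ hρ1 hm hm1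
  have hfin : kantorovichValue (atomic x m) (polyline P ρ) ≠ ⊤ :=
    ne_top_of_le_ne_top ENNReal.ofReal_ne_top
      (hH.kantorovichValue_le hρ (hφ.sum_cellTimes hH hρ) P)
  rw [W2sq_eq_toReal, ← ENNReal.ofReal_le_iff_le_toReal hfin]
  exact le_iInf₂ fun γ hγ => hH.ofReal_dual_le_lintegral hx hρ hm ψ hγ

/-- Strong duality. -/
theorem IsOptimal.W2sq_eq_dual [Nonempty (Fin n)] (hφ : IsOptimal x m P ρ φ) (hH : Generic x P)
    (hx : Function.Injective x) (hρ : ∀ α, 0 ≤ ρ α) (hρ1 : ∑ α, ρ α = 1) (hm : ∀ i, 0 ≤ m i)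
    (hm1 : ∑ i, m i = 1) :
    W2sq (atomic x m) (polyline P ρ) = dual x m φ P ρ := by
  have hmass := hφ.sum_cellTimes hH hρ
  refine le_antisymm ?_ (hH.dual_le_W2sq hx hρ hρ1 hm hm1 φ)
  exact (hH.W2sq_le_cellPlanCost hρ hmass P).trans_eq (hH.cellPlanCost_self hρ hmass)

/-! ### Differentiation in the nodes -/

/-- A function squeezed between two functions that touch it at a point and have the same derivative
there is differentiable at that point, with that derivative. -/
theorem hasFDerivAt_of_le_of_le {H : Type*} [NormedAddCommGroup H] [NormedSpace ℝ H]
    {f g h : H → ℝ} {L : H →L[ℝ] ℝ} {z : H} (hf : HasFDerivAt f L z) (hh : HasFDerivAt h L z)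
    (hfg : ∀ᶠ w in 𝓝 z, f w ≤ g w) (hgh : ∀ᶠ w in 𝓝 z, g w ≤ h w) (hfgz : f z = g z)
    (hghz : g z = h z) : HasFDerivAt g L z := by
  rw [hasFDerivAt_iff_isLittleO] at hf hh ⊢
  refine Asymptotics.IsBigO.trans_isLittleO ?_ (hf.norm_left.add hh.norm_left)
  refine Asymptotics.IsBigO.of_bound 1 ?_
  filter_upwards [hfg, hgh] with w h1 h2
  rw [one_mul]
  refine le_trans ?_ (Real.norm_eq_abs _ ▸ le_abs_self _)
  simp only [Real.norm_eq_abs]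
  rw [abs_le]
  have h3 := neg_abs_le (f w - f z - L (w - z))
  have h4 := le_abs_self (h w - h z - L (w - z))
  have h5 := abs_nonneg (f w - f z - L (w - z))
  have h6 := abs_nonneg (h w - h z - L (w - z))
  constructor <;> linarith

theorem hasDerivAt_of_le_of_le {f g h : ℝ → ℝ} {L z : ℝ} (hf : HasDerivAt f L z)
    (hh : HasDerivAt h L z) (hfg : ∀ᶠ w in 𝓝 z, f w ≤ g w) (hgh : ∀ᶠ w in 𝓝 z, g w ≤ h w)
    (hfgz : f z = g z) (hghz : g z = h z) : HasDerivAt g L z :=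
  hasDerivAt_iff_hasFDerivAt.2
    (hasFDerivAt_of_le_of_le hf.hasFDerivAt hh.hasFDerivAt hfg hgh hfgz hghz)

/-- The derivative in the nodes of `∫₀¹ minᵢ (‖l^α(t) - x_i‖² - φ_i) dt`. -/
def segDeriv (x : Fin n → Pt d) (φ : Fin n → ℝ) (P : Fin (p + 1) → Pt d) (α : Fin p) :
    (Fin (p + 1) → Pt d) →L[ℝ] ℝ :=
  (∑ i, ∫ t in cellTimes x φ P i α, costDeriv x P α i t) ∘L
    ContinuousLinearMap.inl ℝ (Fin (p + 1) → Pt d) (Fin n → ℝ)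

theorem segDeriv_apply (x : Fin n → Pt d) (φ : Fin n → ℝ) (P : Fin (p + 1) → Pt d) (α : Fin p)
    (u : Fin (p + 1) → Pt d) :
    segDeriv x φ P α u =
      ∑ i, ∫ t in cellTimes x φ P i α, 2 * inner ℝ (seg P α t - x i) (seg u α t) := by
  rw [segDeriv, ContinuousLinearMap.comp_apply, _root_.sum_apply]
  refine Finset.sum_congr rfl fun i _ => ?_
  rw [integral_costDeriv_apply]
  simp

/-- The derivative in the nodes of the dual functional at fixed weights. -/
def nodesDeriv (x : Fin n → Pt d) (φ : Fin n → ℝ) (P : Fin (p + 1) → Pt d) (ρ : Fin p → ℝ) :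
    (Fin (p + 1) → Pt d) →L[ℝ] ℝ :=
  ∑ α, ρ α • segDeriv x φ P α

theorem Generic.hasFDerivAt_segMin_nodes [Nonempty (Fin n)] (hH : Generic x P) (φ : Fin n → ℝ)
    (α : Fin p) :
    HasFDerivAt (fun Q => segMin x α (Q, φ)) (segDeriv x φ P α) P :=
  HasFDerivAt.comp (g := segMin x α) (f := fun Q => (Q, φ)) P (hH.hasFDerivAt_segMin φ α)
    (hasFDerivAt_prodMk_left P φ)

theorem Generic.hasFDerivAt_dual_nodes [Nonempty (Fin n)] (hH : Generic x P)
    (hρ : ∀ α, 0 ≤ ρ α) (m φ : Fin n → ℝ) :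
    HasFDerivAt (fun Q => dual x m φ Q ρ) (nodesDeriv x φ P ρ) P := by
  have h : HasFDerivAt (fun Q => ∑ α, ρ α * segMin x α (Q, φ) + ∑ i, m i * φ i)
      (nodesDeriv x φ P ρ) P :=
    (HasFDerivAt.fun_sum fun α _ =>
      (hH.hasFDerivAt_segMin_nodes φ α).const_mul (ρ α)).add_const _
  refine h.congr_of_eventuallyEq ?_
  filter_upwards [eventually_generic hH] with Q hQ using hQ.dual_eq_sum_segMin hρ m φ

/-- At the nodes that define its cells, the cost of the plan has the same derivative as the dual
functional. -/
theorem hasFDerivAt_cellPlanCost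
    (hmass : ∀ i, ∑ α, ρ α * volume.real (cellTimes x φ P i α) = m i) :
    HasFDerivAt (fun Q => cellPlanCost x φ P Q ρ) (nodesDeriv x φ P ρ) P := by
  simp only [cellPlanCost_eq hmass]
  refine (HasFDerivAt.fun_sum fun α _ => ?_).add_const _
  refine HasFDerivAt.const_mul ?_ (ρ α)
  have h := HasFDerivAt.fun_sum (u := Finset.univ) fun i _ =>
    hasFDerivAt_setIntegral_siteCost x α i (cellTimes_subset x φ P i α)
      (measurableSet_cellTimes x φ P i α) (P, φ)
  exact HasFDerivAt.comp (f := fun Q => (Q, φ)) P h (hasFDerivAt_prodMk_left P φ)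

/-- The squared distance is squeezed between the dual functional at the fixed maximizer and the cost
of the fixed plan, so that it inherits their common derivative. -/
theorem IsOptimal.hasFDerivAt_W2sq [Nonempty (Fin n)] (hφ : IsOptimal x m P ρ φ)
    (hH : Generic x P) (hx : Function.Injective x) (hρ : ∀ α, 0 ≤ ρ α) (hρ1 : ∑ α, ρ α = 1)
    (hm : ∀ i, 0 ≤ m i) (hm1 : ∑ i, m i = 1) :
    HasFDerivAt (fun Q => W2sq (atomic x m) (polyline Q ρ)) (nodesDeriv x φ P ρ) P := by
  have hmass := hφ.sum_cellTimes hH hρ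
  have heq := hφ.W2sq_eq_dual hH hx hρ hρ1 hm hm1
  refine hasFDerivAt_of_le_of_le (hH.hasFDerivAt_dual_nodes hρ m φ)
    (hasFDerivAt_cellPlanCost hmass) ?_
    (Eventually.of_forall fun Q => hH.W2sq_le_cellPlanCost hρ hmass Q) heq.symm
    (heq.trans (hH.cellPlanCost_self hρ hmass).symm)
  filter_upwards [eventually_generic hH] with Q hQ using hQ.dual_le_W2sq hx hρ hρ1 hm hm1 φ

/-! ### The torque -/

theorem integral_Icc_zero_one (f : ℝ → ℝ) : ∫ t in Icc (0 : ℝ) 1, f t = ∫ t in (0 : ℝ)..1, f t := by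
  rw [intervalIntegral.integral_of_le zero_le_one, integral_Icc_eq_integral_Ioc]

theorem integrableOn_cellTimes {E : Type*} [NormedAddCommGroup E] (x : Fin n → Pt d)
    (φ : Fin n → ℝ) (P : Fin (p + 1) → Pt d) (i : Fin n) (α : Fin p) {f : ℝ → E}
    (hf : Continuous f) : IntegrableOn f (cellTimes x φ P i α) :=
  (hf.integrableOn_Icc (a := 0) (b := 1)).mono_set (cellTimes_subset x φ P i α)

/-- Over a segment, the derivative of the cost against a `w`-weighted displacement `v`. -/
theorem Generic.sum_setIntegral_inner [Nonempty (Fin n)] (hH : Generic x P) (φ : Fin n → ℝ)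
    (α : Fin p) {w : ℝ → ℝ} (hw : Continuous w) (v : Pt d) :
    ∑ i, ∫ t in cellTimes x φ P i α, 2 * (w t * inner ℝ (seg P α t - x i) v) =
      (∫ t in (0 : ℝ)..1, 2 * w t * ((1 - t) * inner ℝ (P α.castSucc) v +
        t * inner ℝ (P α.succ) v)) -
        2 * inner ℝ (∑ i, ∫ t in cellTimes x φ P i α, w t • x i) v := by
  have h1 : ∀ i, ∫ t in cellTimes x φ P i α, 2 * (w t * inner ℝ (seg P α t - x i) v) =
      (∫ t in cellTimes x φ P i α, 2 * w t * inner ℝ (seg P α t) v) -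
        2 * inner ℝ (∫ t in cellTimes x φ P i α, w t • x i) v := by
    intro i
    rw [integral_smul_const, inner_smul_left, conj_trivial, ← mul_assoc,
      ← integral_const_mul, ← integral_mul_const, ← integral_sub
      (integrableOn_cellTimes x φ P i α (by fun_prop))
      (integrableOn_cellTimes x φ P i α (by fun_prop))]
    congr 1
    ext t
    rw [inner_sub_left]
    ring
  simp only [h1, Finset.sum_sub_distrib]
  rw [hH.sum_setIntegral_cellTimes φ α (f := fun t => 2 * w t * inner ℝ (seg P α t) v)
    (by fun_prop), integral_Icc_zero_one, sum_inner, Finset.mul_sum]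
  simp only [seg, inner_add_left, inner_smul_left, conj_trivial]

theorem Generic.inner_torqueLast [Nonempty (Fin n)] (hH : Generic x P) (φ : Fin n → ℝ)
    (ρ : Fin p → ℝ) (α : Fin p) (v : Pt d) :
    inner ℝ (torqueLast x φ P ρ α) v =
      ρ α * ∑ i, ∫ t in cellTimes x φ P i α, 2 * (t * inner ℝ (seg P α t - x i) v) := by
  rw [hH.sum_setIntegral_inner φ α continuous_id' v, torqueLast, inner_smul_left, conj_trivial,
    sum_meeting_intervalIntegral x φ P α fun i t => t • x i]
  congr 1
  rw [inner_sub_left, inner_add_left, inner_smul_left, inner_smul_left, inner_sub_left,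
    conj_trivial, conj_trivial]
  congr 1
  generalize inner ℝ (P α.castSucc) v = a
  generalize inner ℝ (P α.succ) v = b
  have : ∀ t : ℝ, 2 * t * ((1 - t) * a + t * b) = 2 * a * t + 2 * (b - a) * t ^ 2 :=
    fun t => by ring
  simp only [this]
  rw [intervalIntegral.integral_add (Continuous.intervalIntegrable (by fun_prop) _ _)
    (Continuous.intervalIntegrable (by fun_prop) _ _), intervalIntegral.integral_const_mul,
    intervalIntegral.integral_const_mul, integral_id, integral_pow]
  norm_num
  ring

theorem Generic.inner_torqueFirst [Nonempty (Fin n)] (hH : Generic x P) (φ : Fin n → ℝ)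
    (ρ : Fin p → ℝ) (α : Fin p) (v : Pt d) :
    inner ℝ (torqueFirst x φ P ρ α) v =
      ρ α * ∑ i, ∫ t in cellTimes x φ P i α, 2 * ((1 - t) * inner ℝ (seg P α t - x i) v) := by
  have hrev : ∀ i, ∫ t in (1 - tEnd x φ P i α)..(1 - tStart x φ P i α), t • x i =
      ∫ t in (tStart x φ P i α)..(tEnd x φ P i α), (1 - t) • x i := fun i =>
    (intervalIntegral.integral_comp_sub_left (fun t => t • x i) 1).symm
  rw [hH.sum_setIntegral_inner φ α (by fun_prop : Continuous fun t : ℝ => 1 - t) v, torqueFirst,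
    inner_smul_left, conj_trivial, Finset.sum_congr rfl fun i _ => hrev i,
    sum_meeting_intervalIntegral x φ P α fun i t => (1 - t) • x i]
  congr 1
  rw [inner_sub_left, inner_add_left, inner_smul_left, inner_smul_left, inner_sub_left,
    conj_trivial, conj_trivial]
  congr 1
  generalize inner ℝ (P α.castSucc) v = a
  generalize inner ℝ (P α.succ) v = b
  have : ∀ t : ℝ, 2 * (1 - t) * ((1 - t) * a + t * b) =
      2 * a + (2 * b - 4 * a) * t + 2 * (a - b) * t ^ 2 := fun t => by ring
  simp only [this]
  rw [intervalIntegral.integral_add (Continuous.intervalIntegrable (by fun_prop) _ _)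
    (Continuous.intervalIntegrable (by fun_prop) _ _),
    intervalIntegral.integral_add (Continuous.intervalIntegrable (by fun_prop) _ _)
    (Continuous.intervalIntegrable (by fun_prop) _ _)]
  rw [intervalIntegral.integral_const, intervalIntegral.integral_const_mul,
    intervalIntegral.integral_const_mul, integral_id, integral_pow]
  norm_num
  ring

theorem Generic.nodesDeriv_single [Nonempty (Fin n)] (hH : Generic x P) (φ : Fin n → ℝ)
    (ρ : Fin p → ℝ) (β : Fin (p + 1)) (v : Pt d) :
    nodesDeriv x φ P ρ (Pi.single β v) = inner ℝ (torque x φ P ρ β) v := by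
  rw [nodesDeriv, _root_.sum_apply, torque, sum_inner]
  refine Finset.sum_congr rfl fun α _ => ?_
  rw [_root_.smul_apply, segDeriv_apply, smul_eq_mul, inner_add_left,
    apply_ite (fun z => inner ℝ z v), apply_ite (fun z => inner ℝ z v), inner_zero_left,
    hH.inner_torqueLast, hH.inner_torqueFirst]
  have hne : α.castSucc ≠ α.succ := (Fin.castSucc_lt_succ).ne
  by_cases h1 : α.succ = β
  · have h2 : α.castSucc ≠ β := fun h => hne (h.trans h1.symm)
    rw [if_pos h1, if_neg h2, add_zero]
    simp [seg, h1, h2, inner_smul_right]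
  · by_cases h2 : α.castSucc = β
    · rw [if_neg h1, if_pos h2, zero_add]
      simp [seg, h1, h2, inner_smul_right]
    · rw [if_neg h1, if_neg h2, add_zero]
      simp [seg, h1, h2]

theorem Generic.hasGradientAt_update [Nonempty (Fin n)] (hH : Generic x P) {φ : Fin n → ℝ}
    {ρ : Fin p → ℝ} {F : (Fin (p + 1) → Pt d) → ℝ} (hF : HasFDerivAt F (nodesDeriv x φ P ρ) P)
    (β : Fin (p + 1)) :
    HasGradientAt (fun y => F (Function.update P β y)) (torque x φ P ρ β) (P β) := by
  rw [hasGradientAt_iff_hasFDerivAt]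
  have hu := hasFDerivAt_update (𝕜 := ℝ) P (i := β) (P β)
  have hF' : HasFDerivAt F (nodesDeriv x φ P ρ) (Function.update P β (P β)) := by
    rwa [Function.update_eq_self]
  have hL : nodesDeriv x φ P ρ ∘L ContinuousLinearMap.pi (R := ℝ)
      (φ := fun _ : Fin (p + 1) => Pt d) (Pi.single β (ContinuousLinearMap.id ℝ (Pt d))) =
        (InnerProductSpace.toDual ℝ (Pt d) (torque x φ P ρ β) : Pt d →L[ℝ] ℝ) := by
    refine ContinuousLinearMap.ext fun v => ?_
    have hv : ContinuousLinearMap.pi (R := ℝ) (φ := fun _ : Fin (p + 1) => Pt d)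
        (Pi.single β (ContinuousLinearMap.id ℝ (Pt d))) v = Pi.single β v := by
      ext1 j
      by_cases h : j = β
      · subst h; simp
      · simp [h]
    rw [ContinuousLinearMap.comp_apply, hv, hH.nodesDeriv_single,
      InnerProductSpace.toDual_apply_apply]
  have key := hF'.comp (P β) hu
  rw [hL] at key
  exact key

/-! ### Derivatives along a family of parameters -/

variable {P' : ℝ → Fin (p + 1) → Pt d} {ρ' : ℝ → Fin p → ℝ} {u : Fin (p + 1) → Pt d}
  {σ : Fin p → ℝ}

theorem deriv_cost (hP : HasDerivAt P' u 0) (hρ' : HasDerivAt ρ' σ 0) (x : Fin n → Pt d)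
    (φ : Fin n → ℝ) (i : Fin n) (α : Fin p) (t : ℝ) :
    deriv (fun s => cost x φ (P' s) (ρ' s) i α t) 0 =
      ρ' 0 α * (2 * inner ℝ (seg (P' 0) α t - x i) (seg u α t)) +
        σ α * siteCost x φ i (seg (P' 0) α t) := by
  have h1 : HasDerivAt (fun s => seg (P' s) α t - x i) (seg u α t) 0 :=
    ((segL α t).hasFDerivAt.comp_hasDerivAt (0 : ℝ) hP).sub_const _
  have h2 := (h1.norm_sq.sub_const (φ i)).mul (hasDerivAt_pi.1 hρ' α)
  refine h2.deriv.trans ?_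
  unfold siteCost
  ring

/-- The integrals of the derivatives of the costs add up to the formal derivative of
`∑ α, ρ α * segMin x α (P, φ)`. -/
theorem Generic.interiorTerms_eq [Nonempty (Fin n)] (hH : Generic x (P' 0))
    (hP : HasDerivAt P' u 0) (hρ' : HasDerivAt ρ' σ 0) (φ : Fin n → ℝ) :
    interiorTerms x φ P' ρ' =
      ∑ α, σ α * segMin x α (P' 0, φ) + nodesDeriv x φ (P' 0) (ρ' 0) u := by
  unfold interiorTerms
  rw [sum_incidence x φ (P' 0) fun i α =>
    ∫ t in (tStart x φ (P' 0) i α)..(tEnd x φ (P' 0) i α),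
      deriv (fun s => cost x φ (P' s) (ρ' s) i α t) 0, nodesDeriv, _root_.sum_apply,
    ← Finset.sum_add_distrib]
  refine Finset.sum_congr rfl fun α _ => ?_
  have hsite : ∀ i, ∫ t in cellTimes x φ (P' 0) i α, siteCost x φ i (seg (P' 0) α t) =
      ∫ t in cellTimes x φ (P' 0) i α, minCost x φ (seg (P' 0) α t) := fun i =>
    setIntegral_congr_fun (measurableSet_cellTimes x φ (P' 0) i α) fun t ht =>
      (minCost_eq_of_mem ht.2).symm
  simp only [deriv_cost hP hρ']
  rw [sum_meeting_intervalIntegral x φ (P' 0) α fun i t =>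
    ρ' 0 α * (2 * inner ℝ (seg (P' 0) α t - x i) (seg u α t)) +
        σ α * siteCost x φ i (seg (P' 0) α t), _root_.smul_apply, segDeriv_apply, smul_eq_mul,
    segMin, ← hH.sum_setIntegral_cellTimes φ α (f := fun t => minCost x φ (seg (P' 0) α t))
      (by fun_prop), Finset.mul_sum, Finset.mul_sum, ← Finset.sum_add_distrib]
  refine Finset.sum_congr rfl fun i _ => ?_
  rw [integral_add (integrableOn_cellTimes x φ (P' 0) i α (by fun_prop))
    (integrableOn_cellTimes x φ (P' 0) i α (by fun_prop)), integral_const_mul (σ α),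
    integral_const_mul (ρ' 0 α), hsite, add_comm]

theorem Generic.eventually_comp (hH : Generic x (P' 0)) (hP : ContinuousAt P' 0) :
    ∀ᶠ s in 𝓝 (0 : ℝ), Generic x (P' s) :=
  hP.eventually (eventually_generic hH)

theorem Generic.hasDerivAt_dual [Nonempty (Fin n)] (hH : Generic x (P' 0))
    (hP : HasDerivAt P' u 0) (hρ' : HasDerivAt ρ' σ 0)
    (hnn : ∀ᶠ s in 𝓝 (0 : ℝ), ∀ α, 0 ≤ ρ' s α) (m φ : Fin n → ℝ) :
    HasDerivAt (fun s => dual x m φ (P' s) (ρ' s)) (interiorTerms x φ P' ρ') 0 := by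
  rw [hH.interiorTerms_eq hP hρ' φ]
  have h : HasDerivAt (fun s => ∑ α, ρ' s α * segMin x α (P' s, φ) + ∑ i, m i * φ i)
      (∑ α, (σ α * segMin x α (P' 0, φ) + ρ' 0 α * segDeriv x φ (P' 0) α u)) 0 := by
    refine (HasDerivAt.fun_sum fun α _ => ?_).add_const _
    exact (hasDerivAt_pi.1 hρ' α).mul
      ((hH.hasFDerivAt_segMin_nodes φ α).comp_hasDerivAt (0 : ℝ) hP)
  rw [Finset.sum_add_distrib] at h
  rw [nodesDeriv, _root_.sum_apply]
  refine HasDerivAt.congr_of_eventuallyEq h ?_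
  filter_upwards [hnn, hH.eventually_comp hP.continuousAt] with s hs hHs
  exact hHs.dual_eq_sum_segMin hs m φ

/-! ### Cancellation of the boundary terms -/

/-- A cell that misses a segment still misses it after a small perturbation of the nodes. -/
theorem eventually_notMem_meeting {i : Fin n} {α : Fin p} (h : i ∉ meeting x φ P α) :
    ∀ᶠ Q in 𝓝 P, i ∉ meeting x φ Q α := by
  rw [mem_meeting_iff, not_nonempty_iff_eq_empty] at h
  have key : ∀ᶠ Q in 𝓝 P, ∀ t ∈ Icc (0 : ℝ) 1, seg Q α t ∉ laguerre x φ i := by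
    refine isCompact_Icc.eventually_forall_of_forall_eventually fun t ht => ?_
    have hmem : seg P α t ∉ laguerre x φ i := fun hc =>
      notMem_empty t (h.subset (show t ∈ cellTimes x φ P i α from ⟨ht, hc⟩))
    have hopen : IsOpen {z : (Fin (p + 1) → Pt d) × ℝ | seg z.1 α z.2 ∉ laguerre x φ i} :=
      (isClosed_laguerre x φ i).isOpen_compl.preimage (continuous_seg_uncurry α)
    exact hopen.mem_nhds (x := (P, t)) hmem
  filter_upwards [key] with Q hQ
  rw [mem_meeting_iff, not_nonempty_iff_eq_empty]
  exact eq_empty_of_forall_notMem fun t ht => hQ t ht.1 ht.2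

/-- The integrals of one fixed function `h` over the moving intervals `[tStart, tEnd]` always add up
to its integral over `[0, 1]`, so that their derivatives add up to zero.  For `h` the minimal cost
along the unperturbed segment, these derivatives are the boundary terms. -/
theorem Generic.boundaryTerms_eq_zero [Nonempty (Fin n)] (hH : Generic x (P' 0))
    (hP : HasDerivAt P' u 0) (ρ' : ℝ → Fin p → ℝ)
    (hd : ∀ q ∈ incidence x φ (P' 0),
      DifferentiableAt ℝ (fun s => tStart x φ (P' s) q.1 q.2) 0 ∧
      DifferentiableAt ℝ (fun s => tEnd x φ (P' s) q.1 q.2) 0) :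
    boundaryTerms x φ P' ρ' = 0 := by
  unfold boundaryTerms
  rw [sum_incidence x φ (P' 0) fun i α =>
    (deriv (fun s => tEnd x φ (P' s) i α) 0 *
        cost x φ (P' 0) (ρ' 0) i α (tEnd x φ (P' 0) i α) -
      deriv (fun s => tStart x φ (P' s) i α) 0 *
        cost x φ (P' 0) (ρ' 0) i α (tStart x φ (P' 0) i α))]
  refine Finset.sum_eq_zero fun α _ => ?_
  set h : ℝ → ℝ := fun t => minCost x φ (seg (P' 0) α t) * ρ' 0 α with hh
  have hc : Continuous h := by rw [hh]; fun_prop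
  have hcost : ∀ i t, t ∈ cellTimes x φ (P' 0) i α → cost x φ (P' 0) (ρ' 0) i α t = h t :=
    fun i t ht => congrArg (· * ρ' 0 α) (minCost_eq_of_mem ht.2).symm
  have hder : ∀ i ∈ meeting x φ (P' 0) α,
      HasDerivAt (fun s => ∫ t in (tStart x φ (P' s) i α)..(tEnd x φ (P' s) i α), h t)
        (deriv (fun s => tEnd x φ (P' s) i α) 0 *
            cost x φ (P' 0) (ρ' 0) i α (tEnd x φ (P' 0) i α) -
          deriv (fun s => tStart x φ (P' s) i α) 0 *
            cost x φ (P' 0) (ρ' 0) i α (tStart x φ (P' 0) i α)) 0 := by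
    intro i hi
    obtain ⟨hs, he⟩ := hd (i, α) (by simpa [incidence] using hi)
    have hne := mem_meeting_iff.1 hi
    rw [hcost i _ (tEnd_mem hne), hcost i _ (tStart_mem hne), mul_comm, mul_comm (deriv _ _)]
    have hF : ∀ y, HasDerivAt (fun y => ∫ t in (0 : ℝ)..y, h t) (h y) y := fun y =>
      intervalIntegral.integral_hasDerivAt_right (hc.intervalIntegrable _ _)
        (hc.stronglyMeasurableAtFilter _ _) hc.continuousAt
    have h1 := ((hF (tEnd x φ (P' 0) i α)).comp (0 : ℝ) he.hasDerivAt).sub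
      ((hF (tStart x φ (P' 0) i α)).comp (0 : ℝ) hs.hasDerivAt)
    refine h1.congr_of_eventuallyEq (Eventually.of_forall fun s => ?_)
    exact (intervalIntegral.integral_interval_sub_left (hc.intervalIntegrable _ _)
      (hc.intervalIntegrable _ _)).symm
  have hsum := HasDerivAt.fun_sum hder
  have hconst : (fun s => ∑ i ∈ meeting x φ (P' 0) α,
      ∫ t in (tStart x φ (P' s) i α)..(tEnd x φ (P' s) i α), h t) =ᶠ[𝓝 0]
        fun _ => ∫ t in Icc (0 : ℝ) 1, h t := by
    have hmiss : ∀ᶠ s in 𝓝 (0 : ℝ), ∀ i, i ∉ meeting x φ (P' 0) α → i ∉ meeting x φ (P' s) α := by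
      refine eventually_all.2 fun i => ?_
      by_cases hi : i ∈ meeting x φ (P' 0) α
      · exact Eventually.of_forall fun s h => absurd hi h
      · exact (hP.continuousAt.eventually (eventually_notMem_meeting hi)).mono fun s hs _ => hs
    filter_upwards [hmiss, hH.eventually_comp hP.continuousAt] with s hs hHs
    rw [← hHs.sum_setIntegral_cellTimes φ α hc]
    simp only [← setIntegral_cellTimes]
    refine Finset.sum_subset (Finset.subset_univ _) fun i _ hi => ?_
    have hempty := hs i hi
    rw [mem_meeting_iff, not_nonempty_iff_eq_empty] at hempty
    simp [hempty]
  exact hsum.unique ((hasDerivAt_const (0 : ℝ) _).congr_of_eventuallyEq hconst)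

/-! ### Differentiation of the squared distance along a family -/

/-- Along a family with varying densities, the squared distance is bounded above by the plan cost
for the fixed densities `ρ' 0` plus a correction that is linear in `ρ' s - ρ' 0`.  Continuity of
`ψ` suffices for the correction to have the right derivative, as `ρ' s - ρ' 0` vanishes at
`s = 0`. -/
theorem IsOptimal.hasDerivAt_W2sq [Nonempty (Fin n)] (hφ : IsOptimal x m (P' 0) (ρ' 0) φ)
    (hH : Generic x (P' 0)) (hx : Function.Injective x) (hm : ∀ i, 0 ≤ m i)
    (hm1 : ∑ i, m i = 1) (hP : HasDerivAt P' u 0) (hρ' : HasDerivAt ρ' σ 0)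
    (hnn : ∀ᶠ s in 𝓝 (0 : ℝ), ∀ α, 0 ≤ ρ' s α) (hone : ∀ᶠ s in 𝓝 (0 : ℝ), ∑ α, ρ' s α = 1)
    (halt : (∀ᶠ s in 𝓝 (0 : ℝ), ρ' s = ρ' 0) ∨
      ∃ ψ : ℝ → Fin n → ℝ, ψ 0 = φ ∧ ContinuousAt ψ 0 ∧
        ∀ᶠ s in 𝓝 (0 : ℝ), IsOptimal x m (P' s) (ρ' s) (ψ s)) :
    HasDerivAt (fun s => W2sq (atomic x m) (polyline (P' s) (ρ' s)))
      (interiorTerms x φ P' ρ') 0 := by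
  have hρ0 := hnn.self_of_nhds
  have hρ1 := hone.self_of_nhds
  have hmass := hφ.sum_cellTimes hH hρ0
  have hgen : ∀ᶠ s in 𝓝 (0 : ℝ), Generic x (P' s) :=
    hP.continuousAt.eventually (eventually_generic hH)
  -- for constant densities the correction vanishes, and any `ψ` will do
  obtain ⟨ψ, hψ0, hψc, hψ⟩ : ∃ ψ : ℝ → Fin n → ℝ, ψ 0 = φ ∧ ContinuousAt ψ 0 ∧
      ∀ᶠ s in 𝓝 (0 : ℝ), W2sq (atomic x m) (polyline (P' s) (ρ' s)) ≤
        ∑ α, (ρ' s α - ρ' 0 α) * segMin x α (P' s, ψ s) +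
          cellPlanCost x φ (P' 0) (P' s) (ρ' 0) := by
    rcases halt with hconst | ⟨ψ, hψ0, hψc, hψ⟩
    · refine ⟨fun _ => φ, rfl, continuousAt_const, ?_⟩
      filter_upwards [hconst] with s hs
      rw [hs]
      simpa using hH.W2sq_le_cellPlanCost hρ0 hmass (P' s)
    · refine ⟨ψ, hψ0, hψc, ?_⟩
      filter_upwards [hψ, hgen, hnn, hone] with s hs hHs hns hos
      have h1 := hs.W2sq_eq_dual hHs hx hns hos hm hm1
      have h2 := hHs.dual_le_W2sq hx hρ0 hρ1 hm hm1 (ψ s)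
      have h3 := hH.W2sq_le_cellPlanCost hρ0 hmass (P' s)
      rw [hHs.dual_eq_sum_segMin hns] at h1
      rw [hHs.dual_eq_sum_segMin hρ0] at h2
      simp only [sub_mul, Finset.sum_sub_distrib]
      linarith
  have hcorr : ∀ α, HasDerivAt (fun s => (ρ' s α - ρ' 0 α) * segMin x α (P' s, ψ s))
      (σ α * segMin x α (P' 0, φ)) 0 := by
    intro α
    have hc : ContinuousAt (fun s => segMin x α (P' s, ψ s)) 0 := by
      refine ContinuousAt.comp (g := segMin x α) ?_ (hP.continuousAt.prodMk hψc)
      exact (hH.hasFDerivAt_segMin (ψ 0) α).continuousAt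
    have hr := hasDerivAt_pi.1 hρ' α
    rw [hasDerivAt_iff_tendsto_slope] at hr ⊢
    have ht := hr.mul (hc.tendsto.mono_left (nhdsWithin_le_nhds (s := {(0 : ℝ)}ᶜ)))
    rw [hψ0] at ht
    refine ht.congr fun s => ?_
    simp only [slope_def_field, sub_self, zero_mul, sub_zero]
    ring
  have hupper : HasDerivAt (fun s => ∑ α, (ρ' s α - ρ' 0 α) * segMin x α (P' s, ψ s) +
      cellPlanCost x φ (P' 0) (P' s) (ρ' 0)) (interiorTerms x φ P' ρ') 0 := by
    rw [hH.interiorTerms_eq hP hρ' φ]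
    exact (HasDerivAt.fun_sum fun α _ => hcorr α).add
      ((hasFDerivAt_cellPlanCost hmass).comp_hasDerivAt (0 : ℝ) hP)
  have heq := hφ.W2sq_eq_dual hH hx hρ0 hρ1 hm hm1
  refine hasDerivAt_of_le_of_le (hH.hasDerivAt_dual hP hρ' hnn m φ) hupper ?_ hψ heq.symm ?_
  · filter_upwards [hgen, hnn, hone] with s hHs hns hos
    exact hHs.dual_le_W2sq hx hns hos hm hm1 φ
  · rw [heq, hH.cellPlanCost_self hρ0 hmass]
    simp

end

end PolylineOT

open PolylineOT
theorem mainTheorem1 {d n p : ℕ}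
    (x : Fin n → Pt d) (m : Fin n → ℝ) (P : Fin (p + 1) → Pt d) (ρ : Fin p → ℝ)
    (hm : ∀ i, 0 ≤ m i) (hm1 : ∑ i, m i = 1)
    (hρ : ∀ α, 0 ≤ ρ α) (hρ1 : ∑ α, ρ α = 1)
    (hH : Generic x P) :
    -- the dual problem has a solution
    (∃ φ, IsOptimal x m P ρ φ) ∧
    ∀ φ, IsOptimal x m P ρ φ →
      -- `G(ν) = W₂²(μ, ν) = g(φ*, ν)`
      W2sq (atomic x m) (polyline P ρ) = dual x m φ P ρ ∧
      -- derivatives along an arbitrary family of parameters of `ν`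
      (∀ (P' : ℝ → Fin (p + 1) → Pt d) (ρ' : ℝ → Fin p → ℝ),
        P' 0 = P → ρ' 0 = ρ → DifferentiableAt ℝ P' 0 → DifferentiableAt ℝ ρ' 0 →
        (∀ᶠ s in 𝓝 (0 : ℝ), ∀ α, 0 ≤ ρ' s α) →
          -- the derivative of `g` at fixed `φ*` has no boundary terms
          HasDerivAt (fun s => dual x m φ (P' s) (ρ' s)) (interiorTerms x φ P' ρ') 0 ∧
          -- the boundary terms cancel
          ((∀ q ∈ incidence x φ P,
              DifferentiableAt ℝ (fun s => tStart x φ (P' s) q.1 q.2) 0 ∧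
              DifferentiableAt ℝ (fun s => tEnd x φ (P' s) q.1 q.2) 0) →
            boundaryTerms x φ P' ρ' = 0) ∧
          -- the derivative of `G` is the derivative of `g` at fixed `φ*`
          ((∀ᶠ s in 𝓝 (0 : ℝ), ∑ α, ρ' s α = 1) →
            ((∀ᶠ s in 𝓝 (0 : ℝ), ρ' s = ρ) ∨
              ∃ ψ : ℝ → Fin n → ℝ, ψ 0 = φ ∧ ContinuousAt ψ 0 ∧
                ∀ᶠ s in 𝓝 (0 : ℝ), IsOptimal x m (P' s) (ρ' s) (ψ s)) →
            HasDerivAt (fun s => W2sq (atomic x m) (polyline (P' s) (ρ' s)))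
              (interiorTerms x φ P' ρ') 0)) ∧
      -- the torque formula at every node
      (∀ β : Fin (p + 1),
        HasGradientAt (fun y => W2sq (atomic x m) (polyline (Function.update P β y) ρ))
          (torque x φ P ρ β) (P β) ∧
        HasGradientAt (fun y => dual x m φ (Function.update P β y) ρ)
          (torque x φ P ρ β) (P β)) := by
  have : Nonempty (Fin n) := by
    rcases isEmpty_or_nonempty (Fin n) with h | h
    · simp at hm1
    · exact h
  have hx : Function.Injective x := by
    rcases isEmpty_or_nonempty (Fin p) with h | ⟨⟨α⟩⟩
    · simp at hρ1
    · exact hH.injective α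
  refine ⟨hH.exists_isOptimal hρ hρ1 hm hm1, fun φ hφ =>
    ⟨hφ.W2sq_eq_dual hH hx hρ hρ1 hm hm1, ?_, fun β =>
      ⟨hH.hasGradientAt_update (hφ.hasFDerivAt_W2sq hH hx hρ hρ1 hm hm1) β,
        hH.hasGradientAt_update (hH.hasFDerivAt_dual_nodes hρ m φ) β⟩⟩⟩
  intro P' ρ' hP0 hρ0 hP hρ' hnn
  subst hP0 hρ0
  exact ⟨hH.hasDerivAt_dual hP.hasDerivAt hρ'.hasDerivAt hnn m φ,
    fun hd => hH.boundaryTerms_eq_zero hP.hasDerivAt ρ' hd,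
    fun hone halt => hφ.hasDerivAt_W2sq hH hx hm hm1 hP.hasDerivAt hρ'.hasDerivAt hnn hone halt⟩
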